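/- Let $r\ge 1$ be an integer, $N=r+1$, and let $\hat\Pi_r$ be the projection of the Fock space of one bosonic mode (annihilation operator $\hat a$, $\hat n=\hat a^\dagger\hat a$) onto the span of $|0\rangle,\dots,|r\rangle$. Put $$\hat H_{c,R}=\hat\Pi_r\big[\hat a^\dagger(\hat n-r)+\text{h.c.}\big]\hat\Pi_r,\qquad \hat H_{c,I}=\hat\Pi_r\big[i\,\hat a^\dagger(\hat n-r)+\text{h.c.}\big]\hat\Pi_r,\qquad \hat H_{d,0}=\hat\Pi_r\big[\tfrac{\chi}{2}\hat a^{\dagger2}\hat a^2+\Delta_0\hat a^\dagger\hat a\big]\hat\Pi_r,$$ regarded as $N\times N$ matrices, with $\chi,\Delta_0\in\mathbb R$. Then: 1. $[i\hat H_{c,R},i\hat H_{c,I}]=\sum_{n=0}^r E_n\, i|n\rangle\langle n|$ with $E_n=-2[3n^2-(4r+1)n+r^2]$. This matrix is diagonal and traceless, and its levels are anharmonic: with $\mu_k=E_k-E_{k+1}$ for $0\le k\le N-2$, either $\mu_0\ne0$ and $\mu_k^2\neq\mu_0^2$ for all $k>0$, or $\mu_{N-2}\neq0$ and $\mu_k^2\ne\mu_{N-2}^2$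 for all $k<N-2$. 2. The real Lie algebra generated by $[i\hat H_{c,R},i\hat H_{c,I}]$ and $i\hat H_{c,R}$ is $\mathfrak{su}(N)$, and so is the real Lie algebra generated by $i\hat H_{c,R}$ and $i\hat H_{c,I}$. 3. Let $\chi\ne0$. For every $V\in SU(N)$ and every $T>0$ there is a smooth control $\alpha:\mathbb R\to\mathbb C$ such that the solution on $[0,T]$ of $\dot U(t)=-i\,\chi\big(\operatorname{Re}\alpha(t)\,\hat H_{c,R}+\operatorname{Im}\alpha(t)\,\hat H_{c,I}\big)U(t)$, $U(0)=1$, satisfies $U(T)=V$. 4. Let $\chi\neq0$ and $\Delta_0\in\mathbb R$. For every $V\in SU(N)$ there is a smooth $\alpha:\mathbb R\to\mathbb C$ such that the sped-up controls $\alpha_T(t)=T^{-1}\alpha(t/T)$, $T>0$, have the following two properties. Without drift, $\alpha_T$ steers $1$ to $V$ in time $T$, in the sense of 3, for every $T>0$. With the drift, the solution $W_T$ on $[0,T]$ of $\dot W_T(t)=-i\big[\hat H_{d,0}+\chi\operatorname{Re}\alpha_T(t)\,\hat H_{c,R}+\chi\operatorname{Im}\alpha_T(t)\,\hat H_{c,I}\big]W_T(t)$,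 $W_T(0)=1$, satisfies $W_T(T)\to V$ as $T\to0^+$. -/

import Mathlib

open scoped Matrix ContDiff Topology

attribute [local instance 100] LieRing.ofAssociativeRing

namespace KerrBlockade

/-! ### Fock space operators -/

/-- Finite superpositions of the Fock states `|0⟩, |1⟩, |2⟩, …` of one bosonic mode;
`|n⟩` is `Finsupp.single n 1`. -/
abbrev Fock : Type := ℕ →₀ ℂ

/-- The creation operator `a†`, `a†|n⟩ = √(n+1) |n+1⟩`. -/
noncomputable def create : Module.End ℂ Fock :=
  Finsupp.linearCombination ℂ fun n : ℕ => Finsupp.single (n + 1) ((Real.sqrt (n + 1) : ℝ) : ℂ)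

/-- The annihilation operator `a`, `a|n⟩ = √n |n-1⟩`; for `n = 0` the coefficient vanishes. -/
noncomputable def annihilate : Module.End ℂ Fock :=
  Finsupp.linearCombination ℂ fun n : ℕ => Finsupp.single (n - 1) ((Real.sqrt n : ℝ) : ℂ)

/-- The number operator `n̂ = a† a`. -/
noncomputable def number : Module.End ℂ Fock := create * annihilate

/-- The blockade drive `a† (n̂ - r)`. -/
noncomputable def drive (r : ℕ) : Module.End ℂ Fock :=
  create * (number - (r : ℂ) • 1)

/-- The Hermitian conjugate `(n̂ - r) a` of the blockade drive. -/
noncomputable def driveAdj (r : ℕ) : Module.End ℂ Fock :=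
  (number - (r : ℂ) • 1) * annihilate

/-- Operators on the `(r+1)`-dimensional blockade subspace spanned by `|0⟩, …, |r⟩`, written in
the Fock basis. -/
abbrev Op (r : ℕ) : Type := Matrix (Fin (r + 1)) (Fin (r + 1)) ℂ

/-- The compression `Π_r X Π_r` of `X` to the blockade subspace: the matrix `⟨m|X|n⟩`,
`0 ≤ m, n ≤ r`. -/
noncomputable def compress (r : ℕ) (X : Module.End ℂ Fock) : Op r :=
  Matrix.of fun m n => X (Finsupp.single (n : ℕ) 1) (m : ℕ)

/-! ### The Hamiltonian in the blockade subspace -/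

/-- `H_{c,R} = Π_r (a† (n̂ - r) + h.c.) Π_r`. -/
noncomputable def controlR (r : ℕ) : Op r := compress r (drive r + driveAdj r)

/-- `H_{c,I} = Π_r (i a† (n̂ - r) + h.c.) Π_r`. -/
noncomputable def controlI (r : ℕ) : Op r :=
  compress r (Complex.I • drive r - Complex.I • driveAdj r)

/-- The drift `H_{d,0} = Π_r ((χ/2) a†² a² + Δ₀ a† a) Π_r`. -/
noncomputable def drift (r : ℕ) (χ Δ₀ : ℝ) : Op r :=
  compress r (((χ / 2 : ℝ) : ℂ) • (create ^ 2 * annihilate ^ 2) + (Δ₀ : ℂ) • number)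

/-- The control Hamiltonian `χ Re α H_{c,R} + χ Im α H_{c,I}` at the value `α` of the control,
i.e. the compression of `χ α a† (n̂ - r) + h.c.`. -/
noncomputable def control (r : ℕ) (χ : ℝ) (α : ℂ) : Op r :=
  ((χ * α.re : ℝ) : ℂ) • controlR r + ((χ * α.im : ℝ) : ℂ) • controlI r

/-! ### Lie algebra and levels -/

/-- The real Lie algebra `𝔰𝔲(N)` of traceless skew-Hermitian `N × N` matrices. -/
def su (N : ℕ) : LieSubalgebra ℝ (Matrix (Fin N) (Fin N) ℂ) where
  carrier := {A | Aᴴ = -A ∧ A.trace = 0}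
  add_mem' := by
    rintro A B ⟨hA, hA'⟩ ⟨hB, hB'⟩
    refine ⟨?_, by rw [Matrix.trace_add, hA', hB', add_zero]⟩
    rw [Matrix.conjTranspose_add, hA, hB, neg_add]
  zero_mem' := by simp
  smul_mem' := by
    rintro c A ⟨hA, hA'⟩
    refine ⟨?_, by rw [Matrix.trace_smul, hA', smul_zero]⟩
    rw [Matrix.conjTranspose_smul, hA, star_trivial, smul_neg]
  lie_mem' := by
    rintro A B ⟨hA, -⟩ ⟨hB, -⟩
    constructor
    · rw [Ring.lie_def, Matrix.conjTranspose_sub, Matrix.conjTranspose_mul,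
        Matrix.conjTranspose_mul, hA, hB]
      simp only [neg_mul_neg, neg_sub]
    · rw [Ring.lie_def, Matrix.trace_sub, Matrix.trace_mul_comm, sub_self]

/-- The gap `μ_k = E_k - E_{k+1}`, `0 ≤ k ≤ N - 2`, of levels `E_0, …, E_{N-1}`, where `N = r+1`. -/
def gap {r : ℕ} (E : Fin (r + 1) → ℝ) (k : Fin r) : ℝ := E k.castSucc - E k.succ

/-- The anharmonicity condition: the first gap `μ_0`, or else the last gap `μ_{N-2}`, is nonzero and
its square differs from the squares of all the other gaps. -/
def Anharmonic {r : ℕ} (E : Fin (r + 1) → ℝ) : Prop :=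
  ∃ j : Fin r, ((j : ℕ) = 0 ∨ (j : ℕ) + 1 = r) ∧ gap E j ≠ 0 ∧
    ∀ k : Fin r, k ≠ j → gap E k ^ 2 ≠ gap E j ^ 2

/-- The levels `-2 [3 n² - (4 r + 1) n + r²]`, `0 ≤ n ≤ r`. -/
def level (r : ℕ) (n : Fin (r + 1)) : ℝ :=
  -2 * (3 * (n : ℝ) ^ 2 - (4 * (r : ℝ) + 1) * (n : ℝ) + (r : ℝ) ^ 2)

/-! ### Time evolution -/

/-- `U` is the propagator `U(t) = 𝒯 exp(-i ∫₀ᵗ H)` of the time-dependent Hamiltonian `H` on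
`[0, T]`: the solution of `U'(t) = -i H(t) U(t)`, `U(0) = 1`. -/
def IsPropagator {r : ℕ} (H : ℝ → Op r) (T : ℝ) (U : ℝ → Op r) : Prop :=
  U 0 = 1 ∧ ∀ t ∈ Set.Icc 0 T,
    HasDerivWithinAt U ((-Complex.I) • (H t * U t)) (Set.Icc 0 T) t

/-- The control `α`, given on `[0, 1]`, run on `[0, T]` with the amplitude multiplied by `1 / T`. -/
noncomputable def speedUp (α : ℝ → ℂ) (T : ℝ) (t : ℝ) : ℂ := ((T⁻¹ : ℝ) : ℂ) * α (t / T)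

end KerrBlockade

namespace KerrBlockade

/-! The factor `n̂ - r` kills the transition from `|r⟩` to `|r+1⟩`, so the drive and its adjoint
preserve the blockade subspace and their commutator can be computed in Fock space. It is diagonal
with quadratic levels, whose gaps form an arithmetic progression; the square of the first gap occurs
only once.

Hence double brackets with the diagonal matrix isolate the lowest transition inside `i H_{c,R}`, and
brackets then propagate along the chain of levels to all of `𝔰𝔲(N)` (`exists_hop_mem`, `hop_mem`,
`su_le_of_hop_mem`).

The passage to the group is `specialUnitaryGroup_le_of_lieSpan_eq`. Conjugates of the generators by
reachable elements already span `𝔰𝔲(N)`, so products of their one-parameter groups cover a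
neighbourhood of `1` in `SU(N)`; roots of exponentials then give the whole group. Smooth controls
supply the one-parameter groups, and their endpoints form a monoid (`exp_mem_reachable`,
`Steers.trans`).

Speeding a control up by `1/T` leaves the drift-free endpoint fixed. In rescaled time the drift is
multiplied by `T`, and Grönwall's inequality makes its effect vanish
(`tendsto_solution_perturbation`). -/

/-! ### Matrix elements of the control Hamiltonians -/

/-- The matrix element `⟨n+1| a† (n̂ - r) |n⟩ = √(n+1) (n - r)`. -/
noncomputable def amp (r n : ℕ) : ℝ := Real.sqrt (n + 1) * ((n : ℝ) - r)

lemma create_single (n : ℕ) (z : ℂ) :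
    create (Finsupp.single n z) = Finsupp.single (n + 1) (z * (Real.sqrt (n + 1) : ℝ)) := by
  simp [create, Finsupp.linearCombination_single]

lemma annihilate_single_zero (z : ℂ) : annihilate (Finsupp.single 0 z) = 0 := by
  simp [annihilate, Finsupp.linearCombination_single]

lemma annihilate_single_succ (n : ℕ) (z : ℂ) :
    annihilate (Finsupp.single (n + 1) z) = Finsupp.single n (z * (Real.sqrt (n + 1) : ℝ)) := by
  simp [annihilate, Finsupp.linearCombination_single]

lemma ofReal_sqrt_mul_self (n : ℕ) :
    ((Real.sqrt (n + 1) : ℝ) : ℂ) * (Real.sqrt (n + 1) : ℝ) = n + 1 := by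
  rw [← Complex.ofReal_mul, Real.mul_self_sqrt (by positivity)]
  push_cast
  rfl

lemma number_single (n : ℕ) (z : ℂ) :
    number (Finsupp.single n z) = Finsupp.single n (z * n) := by
  cases n with
  | zero => simp [number, annihilate_single_zero]
  | succ n =>
    rw [number, Module.End.mul_apply, annihilate_single_succ, create_single, mul_assoc,
      ofReal_sqrt_mul_self]
    push_cast
    rfl

lemma drive_single (r n : ℕ) (z : ℂ) :
    drive r (Finsupp.single n z) = Finsupp.single (n + 1) (z * (amp r n : ℝ)) := by
  have h : (number - (r : ℂ) • 1) (Finsupp.single n z) = Finsupp.single n (z * (n - r)) := by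
    rw [LinearMap.sub_apply, number_single, LinearMap.smul_apply, Module.End.one_apply,
      Finsupp.smul_single, ← Finsupp.single_sub]
    congr 1
    simp only [smul_eq_mul]
    ring
  rw [drive, Module.End.mul_apply, h, create_single]
  congr 1
  simp only [amp]
  push_cast
  ring

lemma driveAdj_single_zero (r : ℕ) (z : ℂ) : driveAdj r (Finsupp.single 0 z) = 0 := by
  rw [driveAdj, Module.End.mul_apply, annihilate_single_zero, map_zero]

lemma driveAdj_single_succ (r n : ℕ) (z : ℂ) :
    driveAdj r (Finsupp.single (n + 1) z) = Finsupp.single n (z * (amp r n : ℝ)) := by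
  rw [driveAdj, Module.End.mul_apply, annihilate_single_succ, LinearMap.sub_apply, number_single,
    LinearMap.smul_apply, Module.End.one_apply, Finsupp.smul_single, ← Finsupp.single_sub]
  congr 1
  simp only [amp, smul_eq_mul]
  push_cast
  ring

lemma amp_self (r : ℕ) : amp r r = 0 := by simp [amp]

lemma amp_ne_zero {r n : ℕ} (h : n < r) : amp r n ≠ 0 := by
  have : (n : ℝ) < r := by exact_mod_cast h
  exact mul_ne_zero (Real.sqrt_ne_zero'.2 (by positivity)) (sub_neg.2 this).ne

lemma amp_mul_self (r n : ℕ) : amp r n * amp r n = (n + 1) * ((n : ℝ) - r) ^ 2 := by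
  have := Real.mul_self_sqrt (show (0 : ℝ) ≤ n + 1 by positivity)
  simp only [amp]
  linear_combination ((n : ℝ) - r) ^ 2 * this

/-- `X` maps the blockade subspace into itself. -/
def Blockades (r : ℕ) (X : Module.End ℂ Fock) : Prop :=
  ∀ n ≤ r, ∀ m, r < m → X (Finsupp.single n 1) m = 0

lemma blockades_drive (r : ℕ) : Blockades r (drive r) := by
  intro n hn m hm
  rw [drive_single]
  rcases hn.eq_or_lt with rfl | hn
  · simp [amp_self]
  · rw [Finsupp.single_apply, if_neg (by omega)]

lemma blockades_driveAdj (r : ℕ) : Blockades r (driveAdj r) := by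
  intro n hn m hm
  cases n with
  | zero => rw [driveAdj_single_zero]; rfl
  | succ n => rw [driveAdj_single_succ, Finsupp.single_apply, if_neg (by omega)]

lemma compress_sub (r : ℕ) (X Y : Module.End ℂ Fock) :
    compress r (X - Y) = compress r X - compress r Y := by
  ext m n; simp [compress]

lemma compress_smul (r : ℕ) (c : ℂ) (X : Module.End ℂ Fock) :
    compress r (c • X) = c • compress r X := rfl

/-- Compression is not multiplicative in general. Here the projection between the two factors acts
as the identity, because `Y` does not leave the subspace. -/
lemma compress_mul {r : ℕ} (X : Module.End ℂ Fock) {Y : Module.End ℂ Fock}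
    (hY : Blockades r Y) : compress r (X * Y) = compress r X * compress r Y := by
  ext m n
  have h : Y (Finsupp.single (n : ℕ) 1) =
      ∑ l : Fin (r + 1), Y (Finsupp.single (n : ℕ) 1) l • Finsupp.single (l : ℕ) (1 : ℂ) := by
    ext k
    rw [Finsupp.finsetSum_apply]
    by_cases hk : k < r + 1
    · rw [Finset.sum_eq_single (⟨k, hk⟩ : Fin (r + 1))]
      · simp
      · intro b _ hb
        have : (b : ℕ) ≠ k := fun h => hb (Fin.ext h)
        simp [this]
      · simp
    · rw [hY n (by omega) k (by omega), Finset.sum_eq_zero]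
      intro b _
      have : (b : ℕ) ≠ k := by omega
      simp [this]
  simp only [compress, Matrix.of_apply, Matrix.mul_apply, Module.End.mul_apply]
  conv_lhs => rw [h]
  rw [map_sum, Finsupp.finsetSum_apply]
  refine Finset.sum_congr rfl fun l _ => ?_
  rw [map_smul, Finsupp.smul_apply, smul_eq_mul, mul_comm]

lemma controlR_eq (r : ℕ) : controlR r = compress r (drive r) + compress r (driveAdj r) := rfl

lemma controlI_eq (r : ℕ) :
    controlI r = Complex.I • compress r (drive r) - Complex.I • compress r (driveAdj r) := by
  rw [controlI, compress_sub, compress_smul, compress_smul]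

/-- In Fock space both products are diagonal, with entries `n (n-1-r)²` and `(n+1)(n-r)²`; the cubic
terms cancel in the difference. -/
lemma compress_drive_mul_driveAdj_sub (r : ℕ) :
    (2 : ℂ) • (compress r (drive r) * compress r (driveAdj r) -
      compress r (driveAdj r) * compress r (drive r)) =
    Matrix.diagonal fun n => (level r n : ℂ) := by
  rw [← compress_mul _ (blockades_drive r), ← compress_mul _ (blockades_driveAdj r),
    ← compress_sub, ← compress_smul]
  ext m n
  have h1 : (driveAdj r * drive r) (Finsupp.single (n : ℕ) 1) =
      Finsupp.single (n : ℕ) (((n + 1) * ((n : ℝ) - r) ^ 2 : ℝ) : ℂ) := by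
    rw [Module.End.mul_apply, drive_single, driveAdj_single_succ, mul_assoc,
      ← Complex.ofReal_mul, amp_mul_self, one_mul]
  have h2 : (drive r * driveAdj r) (Finsupp.single (n : ℕ) 1) =
      Finsupp.single (n : ℕ) ((n * ((n : ℝ) - 1 - r) ^ 2 : ℝ) : ℂ) := by
    rw [Module.End.mul_apply]
    obtain ⟨n, hn⟩ := n
    cases n with
    | zero => simp [driveAdj_single_zero]
    | succ n =>
      rw [driveAdj_single_succ, drive_single, mul_assoc, ← Complex.ofReal_mul, amp_mul_self,
        one_mul]
      congr 2
      push_cast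
      ring
  rw [compress, Matrix.of_apply, LinearMap.smul_apply, LinearMap.sub_apply, h1, h2,
    ← Finsupp.single_sub, Finsupp.smul_single, Finsupp.single_apply, Matrix.diagonal_apply]
  by_cases h : m = n
  · subst h
    rw [if_pos rfl, if_pos rfl, level, smul_eq_mul]
    push_cast
    ring
  · rw [if_neg h, if_neg (fun h' => h (Fin.ext h'.symm))]

/-- With `P` the compressed drive and `Q` its adjoint, the two generators are `i(P+Q)` and `Q-P`,
whose bracket is `2i(PQ-QP)`. -/
lemma lie_controlR_controlI (r : ℕ) :
    ⁅Complex.I • controlR r, Complex.I • controlI r⁆ =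
      Matrix.diagonal fun n => Complex.I * (level r n : ℂ) := by
  have h := congrArg (Complex.I • ·) (compress_drive_mul_driveAdj_sub r)
  have hd : Complex.I • Matrix.diagonal (fun n => (level r n : ℂ)) =
      Matrix.diagonal fun n => Complex.I * (level r n : ℂ) := by
    rw [← Matrix.diagonal_smul]; rfl
  rw [← hd, ← h, Ring.lie_def, controlR_eq, controlI_eq]
  set P := compress r (drive r)
  set Q := compress r (driveAdj r)
  have hY : Complex.I • (Complex.I • P - Complex.I • Q) = Q - P := by
    rw [← smul_sub, smul_smul, Complex.I_mul_I, neg_one_smul, neg_sub]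
  rw [hY]
  simp only [smul_mul_assoc, mul_smul_comm, mul_sub, sub_mul, mul_add, add_mul]
  module

/-- The gaps are `μ_k = 4(3k+1-2r)`, so `μ_k² - μ_0² = 48 k (3k+2-4r)`, and the last factor is
negative for `k ≤ r-1`. -/
lemma anharmonic_level_zero {r : ℕ} (hr : 1 ≤ r) (k : Fin r) :
    gap (level r) ⟨0, hr⟩ ≠ 0 ∧ (k ≠ ⟨0, hr⟩ → gap (level r) k ^ 2 ≠ gap (level r) ⟨0, hr⟩ ^ 2) := by
  have hg : ∀ k : Fin r, gap (level r) k = 4 * (3 * (k : ℝ) + 1 - 2 * r) := by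
    intro k
    simp only [gap, level, Fin.val_castSucc, Fin.val_succ]
    push_cast
    ring
  have hr' : (1 : ℝ) ≤ r := by exact_mod_cast hr
  rw [hg, hg]
  simp only [Nat.cast_zero]
  refine ⟨fun h => by linarith, fun hk h => ?_⟩
  have hk0 : (1 : ℝ) ≤ (k : ℕ) := by
    have : (k : ℕ) ≠ 0 := fun h => hk (Fin.ext h)
    exact_mod_cast Nat.one_le_iff_ne_zero.2 this
  have hk1 : ((k : ℕ) : ℝ) + 1 ≤ r := by exact_mod_cast k.2
  have : ((k : ℕ) : ℝ) * (3 * (k : ℕ) + 2 - 4 * r) = 0 := by linear_combination h / 48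
  rcases mul_eq_zero.1 this with h | h <;> linarith

lemma anharmonic_level {r : ℕ} (hr : 1 ≤ r) : Anharmonic (level r) :=
  ⟨⟨0, hr⟩, Or.inl rfl, (anharmonic_level_zero hr ⟨0, hr⟩).1,
    fun k hk => (anharmonic_level_zero hr k).2 hk⟩

/-! ### Generation of `𝔰𝔲(N)` -/

section Generation

variable {n : Type*} [DecidableEq n]

/-- The skew-Hermitian matrix `z |i⟩⟨j| - z̄ |j⟩⟨i|`. -/
def skew (i j : n) (z : ℂ) : Matrix n n ℂ :=
  Matrix.single i j z - Matrix.single j i (star z)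

lemma skew_add (i j : n) (z w : ℂ) : skew i j (z + w) = skew i j z + skew i j w := by
  simp only [skew, star_add, Matrix.single_add]
  abel

lemma skew_smul (i j : n) (c : ℝ) (z : ℂ) : skew i j ((c : ℂ) * z) = c • skew i j z := by
  simp [skew, smul_sub, Matrix.smul_single]

lemma skew_zero (i j : n) : skew i j 0 = 0 := by simp [skew]

lemma skew_swap (i j : n) (z : ℂ) : skew j i z = skew i j (-star z) := by
  ext a b
  simp only [skew, star_neg, star_star, Matrix.sub_apply, Matrix.single_apply]
  split_ifs <;> ring

/-- On the diagonal `skew i i z` is `z - z̄ = 2i Im z` times a matrix unit; this is the origin of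
the entries 2. -/
lemma skew_self_I_sub (i j : n) :
    skew j j Complex.I - skew i i Complex.I =
      Matrix.diagonal fun l => Complex.I *
        (((if l = j then 2 else 0) - (if l = i then 2 else 0) : ℝ) : ℂ) := by
  ext a b
  simp only [skew, Complex.star_def, Complex.conj_I, Matrix.sub_apply, Matrix.single_apply,
    Matrix.diagonal_apply]
  by_cases hab : a = b
  · subst hab
    simp only [and_self, if_true, eq_comm (a := j), eq_comm (a := i)]
    split_ifs <;> push_cast <;> ring
  · have h : ∀ l : n, ¬ (l = a ∧ l = b) := fun l h => hab (h.1.symm.trans h.2)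
    simp [hab, h]

variable [Fintype n]

lemma lie_skew_skew {i j k : n} (hij : i ≠ j) (hjk : j ≠ k) (hik : i ≠ k) (z w : ℂ) :
    ⁅skew i j z, skew j k w⁆ = skew i k (z * w) := by
  simp [skew, Ring.lie_def, mul_sub, sub_mul, Matrix.single_mul_single_of_ne, hij, hjk, hik,
    hij.symm, hjk.symm, hik.symm, mul_comm]

lemma lie_skew_skew_one {i j : n} (hij : i ≠ j) (z : ℂ) :
    ⁅skew i j z, skew i j 1⁆ = skew j j z - skew i i z := by
  simp [skew, Ring.lie_def, mul_sub, sub_mul, Matrix.single_mul_single_of_ne, hij, hij.symm]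
  abel

lemma lie_diagonal_skew (F : n → ℝ) (i j : n) (z : ℂ) :
    ⁅Matrix.diagonal (fun l => Complex.I * (F l : ℂ)), skew i j z⁆ =
      skew i j (Complex.I * ((F i - F j : ℝ) : ℂ) * z) := by
  ext a b
  simp only [skew, Ring.lie_def, Matrix.sub_apply, Matrix.diagonal_mul, Matrix.mul_diagonal,
    Matrix.single_apply, mul_sub, sub_mul, mul_ite, ite_mul, mul_zero, zero_mul]
  have hs : star (Complex.I * ((F i - F j : ℝ) : ℂ) * z) =
      -(Complex.I * ((F i - F j : ℝ) : ℂ) * star z) := by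
    simp only [star_mul', Complex.star_def, Complex.conj_I, Complex.conj_ofReal]
    ring
  rw [hs]
  have h1 : (if i = a ∧ j = b then Complex.I * (F a : ℂ) * z else 0) -
      (if i = a ∧ j = b then z * (Complex.I * (F b : ℂ)) else 0) =
      if i = a ∧ j = b then Complex.I * ((F i - F j : ℝ) : ℂ) * z else 0 := by
    split_ifs with h
    · rw [h.1, h.2]; push_cast; ring
    · simp
  have h2 : (if j = a ∧ i = b then Complex.I * (F a : ℂ) * star z else 0) -
      (if j = a ∧ i = b then star z * (Complex.I * (F b : ℂ)) else 0) =
      if j = a ∧ i = b then -(Complex.I * ((F i - F j : ℝ) : ℂ) * star z) else 0 := by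
    split_ifs with h
    · rw [h.1, h.2]; push_cast; ring
    · simp
  rw [← h1, ← h2]
  ring

/-- The double sum is `A - Aᴴ`: every pair of indices is counted in both orders. -/
lemma two_smul_eq_sum_skew {A : Matrix n n ℂ} (hA : Aᴴ = -A) :
    (2 : ℝ) • A = ∑ i, ∑ j, skew i j (A i j) := by
  have h1 : ∑ i, ∑ j, Matrix.single j i (star (A i j)) = Aᴴ := by
    rw [Finset.sum_comm]
    exact (Matrix.matrix_eq_sum_single Aᴴ).symm
  simp only [skew, Finset.sum_sub_distrib]
  rw [← Matrix.matrix_eq_sum_single, h1, hA, sub_neg_eq_add, two_smul]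

end Generation

section Chain

variable {r : ℕ}

/-- The matrix `z |k⟩⟨k+1| - z̄ |k+1⟩⟨k|` between neighbouring levels. -/
def hop (k : Fin r) (z : ℂ) : Op r := skew k.castSucc k.succ z

lemma lie_diagonal_sum_hop (F : Fin (r + 1) → ℝ) (z : Fin r → ℂ) :
    ⁅Matrix.diagonal (fun l => Complex.I * (F l : ℂ)), ∑ k, hop k (z k)⁆ =
      ∑ k, hop k (Complex.I * (gap F k : ℂ) * z k) := by
  rw [lie_sum]
  exact Finset.sum_congr rfl fun k _ => lie_diagonal_skew F _ _ _

variable {L : LieSubalgebra ℝ (Op r)}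

/-- The numbers `w` and `i c w` form a real basis of `ℂ`. The second typically arises from the first
by a bracket with a diagonal matrix. -/
lemma skew_mem_of_mem {n : ℕ} {L : LieSubalgebra ℝ (Matrix (Fin n) (Fin n) ℂ)} {i j : Fin n}
    {w : ℂ} {c : ℝ} (hw : w ≠ 0) (hc : c ≠ 0) (h1 : skew i j w ∈ L)
    (h2 : skew i j (Complex.I * (c : ℂ) * w) ∈ L) (z : ℂ) : skew i j z ∈ L := by
  have hz : z = ((z / w).re : ℂ) * w +
      (((z / w).im / c : ℝ) : ℂ) * (Complex.I * (c : ℂ) * w) := by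
    have hc' : (c : ℂ) ≠ 0 := by exact_mod_cast hc
    have h : z = ((z / w).re + (z / w).im * Complex.I) * w := by
      rw [Complex.re_add_im, div_mul_cancel₀ _ hw]
    conv_lhs => rw [h]
    push_cast
    field_simp
  rw [hz, skew_add, skew_smul, skew_smul]
  exact L.add_mem (L.smul_mem _ h1) (L.smul_mem _ h2)

/-- A level gap whose square is unlike all the others isolates its transition. -/
lemma exists_hop_mem {E : Fin (r + 1) → ℝ}
    (hD : Matrix.diagonal (fun l => Complex.I * (E l : ℂ)) ∈ L) {z : Fin r → ℂ}
    (hz : ∀ k, z k ≠ 0) (hX : ∑ k, hop k (z k) ∈ L) {j : Fin r}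
    (hj : ∀ k, k ≠ j → gap E k ^ 2 ≠ gap E j ^ 2) :
    ∃ w : ℂ, w ≠ 0 ∧ hop j w ∈ L := by
  have key : ∀ S : Finset (Fin r), j ∉ S →
      ∃ w : Fin r → ℂ, w j ≠ 0 ∧ (∀ k ∈ S, w k = 0) ∧ ∑ k, hop k (w k) ∈ L := by
    intro S
    induction S using Finset.induction_on with
    | empty => exact fun _ => ⟨z, hz j, by simp, hX⟩
    | insert a S _ ih =>
      intro hS
      rw [Finset.mem_insert, not_or] at hS
      obtain ⟨w, hwj, hwS, hw⟩ := ih hS.2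
      -- The double bracket with the diagonal matrix multiplies the `k`-th coefficient by `-μ_k²`.
      -- Adding `μ_a²` times the original sum therefore kills transition `a` and keeps transition
      -- `j`.
      refine ⟨fun k => ((gap E a ^ 2 - gap E k ^ 2 : ℝ) : ℂ) * w k, ?_, ?_, ?_⟩
      · refine mul_ne_zero ?_ hwj
        exact_mod_cast sub_ne_zero.2 (hj a (Ne.symm hS.1))
      · intro k hk
        rcases Finset.mem_insert.1 hk with rfl | hk
        · simp
        · simp [hwS k hk]
      · have h2 := L.lie_mem hD (L.lie_mem hD hw)
        rw [lie_diagonal_sum_hop, lie_diagonal_sum_hop] at h2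
        have h3 := L.add_mem (L.smul_mem (gap E a ^ 2) hw) h2
        rw [Finset.smul_sum, ← Finset.sum_add_distrib] at h3
        refine (congrArg (· ∈ L) (Finset.sum_congr rfl fun k _ => ?_)).mp h3
        simp only [hop]
        rw [← skew_smul, ← skew_add]
        congr 1
        push_cast
        linear_combination (gap E k : ℂ) ^ 2 * w k * Complex.I_sq
  obtain ⟨w, hwj, hwS, hw⟩ := key (Finset.univ.erase j) (by simp)
  refine ⟨w j, hwj, ?_⟩
  rwa [Finset.sum_eq_single j] at hw
  · intro b _ hb
    rw [hwS b (by simp [hb]), hop, skew_zero]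
  · simp

/-- Anharmonicity is needed only to isolate the bottom transition; every higher one is obtained from
those below it. -/
lemma hop_mem {E : Fin (r + 1) → ℝ} (hr : 1 ≤ r)
    (hD : Matrix.diagonal (fun l => Complex.I * (E l : ℂ)) ∈ L) {z : Fin r → ℂ}
    (hz : ∀ k, z k ≠ 0) (hX : ∑ k, hop k (z k) ∈ L) (h0 : gap E ⟨0, hr⟩ ≠ 0)
    (hj : ∀ k, k ≠ ⟨0, hr⟩ → gap E k ^ 2 ≠ gap E ⟨0, hr⟩ ^ 2) (k : Fin r) (w : ℂ) :
    hop k w ∈ L := by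
  obtain ⟨k, hk⟩ := k
  induction k using Nat.strong_induction_on generalizing w with
  | _ k ih =>
    cases k with
    | zero =>
      obtain ⟨v, hv, hvL⟩ := exists_hop_mem hD hz hX hj
      refine skew_mem_of_mem hv h0 hvL ?_ w
      have := L.lie_mem hD hvL
      rwa [hop, lie_diagonal_skew] at this
    | succ k =>
      have hk' : k < r := by omega
      set p : Fin r := ⟨k, hk'⟩
      set q : Fin r := ⟨k + 1, hk⟩
      have hne : p.castSucc ≠ p.succ := p.castSucc_lt_succ.ne
      have hF := L.lie_mem (ih k (by omega) Complex.I hk') (ih k (by omega) 1 hk')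
      rw [hop, hop, lie_skew_skew_one hne, skew_self_I_sub] at hF
      -- The bracket of two hops at `k` is diagonal, with levels `-2` at `k` and `2` at `k+1`. Its
      -- gaps vanish except at `k-1`, `k`, `k+1`, so its bracket with the full sum contains one new
      -- transition besides those already obtained.
      set F : Fin (r + 1) → ℝ := fun l =>
        (if l = p.succ then 2 else 0) - (if l = p.castSucc then 2 else 0) with hFdef
      have hqF : gap F q = 2 := by
        have : ¬ k + 1 + 1 = k := by omega
        simp [gap, hFdef, Fin.ext_iff, p, q, this]
      have hsum := L.lie_mem hF hX
      rw [lie_diagonal_sum_hop, ← Finset.add_sum_erase _ _ (Finset.mem_univ q)] at hsum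
      have hrest : ∑ l ∈ Finset.univ.erase q, hop l (Complex.I * (gap F l : ℂ) * z l) ∈ L := by
        refine sum_mem fun l hl => ?_
        have hlq : (l : ℕ) ≠ k + 1 := fun h => (Finset.mem_erase.1 hl).1 (Fin.ext h)
        by_cases hlk : (l : ℕ) < k + 1
        · exact ih l hlk _ l.2
        · have : gap F l = 0 := by
            have h1 : (l : ℕ) ≠ k := by omega
            have h2 : (l : ℕ) + 1 ≠ k := by omega
            simp [gap, hFdef, Fin.ext_iff, p, h1, h2, hlq]
          rw [this, Complex.ofReal_zero, mul_zero, zero_mul, hop, skew_zero]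
          exact L.zero_mem
      have hq := (L.toSubmodule.add_mem_iff_left hrest).1 hsum
      -- A second bracket turns the phase by a quarter, which yields all complex coefficients.
      have hq2 := L.lie_mem hF hq
      rw [hop, lie_diagonal_skew] at hq2
      refine skew_mem_of_mem (c := gap F q) ?_ (by rw [hqF]; norm_num) hq hq2 w
      rw [hqF]
      simp [hz q]

lemma skew_mem_of_hop_mem (h : ∀ (k : Fin r) (w : ℂ), hop k w ∈ L) {i j : Fin (r + 1)}
    (hij : i ≠ j) (w : ℂ) : skew i j w ∈ L := by
  -- Induction on the distance `d + 1` between the levels: a bracket with a hop lengthens a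
  -- transition by one.
  have key : ∀ (d : ℕ) (i j : Fin (r + 1)), (j : ℕ) = i + d + 1 → ∀ w : ℂ, skew i j w ∈ L := by
    intro d
    induction d with
    | zero =>
      intro i j hij w
      have := h ⟨i, by omega⟩ w
      rwa [hop, show (Fin.castSucc ⟨i, _⟩ : Fin (r + 1)) = i from rfl,
        show (Fin.succ ⟨i, _⟩ : Fin (r + 1)) = j from Fin.ext hij.symm] at this
    | succ d ih =>
      intro i j hij w
      let m : Fin (r + 1) := ⟨i + d + 1, by omega⟩
      have h1 := ih i m rfl w
      have h2 := h ⟨i + d + 1, by omega⟩ 1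
      rw [hop, show (Fin.castSucc ⟨i + d + 1, _⟩ : Fin (r + 1)) = m from rfl,
        show (Fin.succ ⟨i + d + 1, _⟩ : Fin (r + 1)) = j from Fin.ext hij.symm] at h2
      have h3 := L.lie_mem h1 h2
      rwa [lie_skew_skew (by simp [Fin.ext_iff, m]; omega) (by simp [Fin.ext_iff, m]; omega)
        (by simp [Fin.ext_iff]; omega), mul_one] at h3
  rcases lt_or_gt_of_ne hij with h | h
  · exact key (j - i - 1) i j (by omega) w
  · rw [skew_swap]
    exact key (i - j - 1) j i (by omega) _

lemma su_le_of_hop_mem (h : ∀ (k : Fin r) (w : ℂ), hop k w ∈ L) : su (r + 1) ≤ L := by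
  rintro A ⟨hA, htr⟩
  have hsk := fun {i j : Fin (r + 1)} (hij : i ≠ j) (w : ℂ) => skew_mem_of_hop_mem h hij w
  have hdiag : ∀ (i j : Fin (r + 1)) (w : ℂ), skew j j w - skew i i w ∈ L := by
    intro i j w
    rcases eq_or_ne i j with rfl | hij
    · rw [sub_self]; exact L.zero_mem
    · rw [← lie_skew_skew_one hij]
      exact L.lie_mem (hsk hij w) (hsk hij 1)
  have hsum : ∀ s : Finset (Fin (r + 1)),
      ∑ i ∈ s, skew (0 : Fin (r + 1)) 0 (A i i) = skew 0 0 (∑ i ∈ s, A i i) := by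
    intro s
    induction s using Finset.induction_on with
    | empty => simp [skew_zero]
    | insert a s ha ih => rw [Finset.sum_insert ha, Finset.sum_insert ha, skew_add, ih]
  -- Vanishing trace allows every `skew i i` to be replaced by its difference with `skew 0 0`, which
  -- is zero or a bracket of off-diagonal elements.
  have h0 : ∑ i, skew (0 : Fin (r + 1)) 0 (A i i) = 0 := by
    rw [hsum, show ∑ i, A i i = 0 from htr, skew_zero]
  have h2A : (2 : ℝ) • A ∈ L := by
    rw [two_smul_eq_sum_skew hA]
    have : ∑ i, ∑ j, skew i j (A i j) =
        ∑ i, ((∑ j ∈ Finset.univ.erase i, skew i j (A i j)) +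
          (skew i i (A i i) - skew 0 0 (A i i))) := by
      rw [Finset.sum_add_distrib, Finset.sum_sub_distrib, h0, sub_zero, ← Finset.sum_add_distrib]
      exact Finset.sum_congr rfl fun i _ => (Finset.sum_erase_add _ _ (Finset.mem_univ i)).symm
    rw [this]
    exact sum_mem fun i _ => L.add_mem
      (sum_mem fun j hj => hsk (Finset.ne_of_mem_erase hj).symm _) (hdiag _ _ _)
  have := L.smul_mem (1 / 2 : ℝ) h2A
  rwa [smul_smul, show (1 / 2 : ℝ) * 2 = 1 by norm_num, one_smul] at this

end Chain

/-! ### The control Hamiltonians as generators of `𝔰𝔲(r+1)` -/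

lemma compress_drive_apply (r : ℕ) (m n : Fin (r + 1)) :
    compress r (drive r) m n = if (n : ℕ) + 1 = m then (amp r n : ℂ) else 0 := by
  rw [compress, Matrix.of_apply, drive_single, Finsupp.single_apply, one_mul]

lemma compress_driveAdj (r : ℕ) : compress r (driveAdj r) = (compress r (drive r))ᴴ := by
  ext m n
  rw [Matrix.conjTranspose_apply, compress_drive_apply, compress, Matrix.of_apply]
  obtain ⟨n, hn⟩ := n
  cases n with
  | zero => simp [driveAdj_single_zero]
  | succ n =>
    rw [driveAdj_single_succ, Finsupp.single_apply, one_mul]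
    by_cases h : n = m
    · subst h; simp
    · have h' : ¬ (m : ℕ) = n := fun h' => h h'.symm
      simp [h, h']

lemma compress_drive_eq_sum (r : ℕ) :
    compress r (drive r) = ∑ k : Fin r, Matrix.single k.succ k.castSucc (amp r k : ℂ) := by
  ext m n
  rw [compress_drive_apply, Matrix.sum_apply]
  by_cases h : (n : ℕ) + 1 = m
  · have hn : (n : ℕ) < r := by omega
    rw [if_pos h, Finset.sum_eq_single ⟨n, hn⟩]
    · rw [Matrix.single_apply, if_pos ⟨Fin.ext h, Fin.ext rfl⟩]
    · intro b _ hb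
      rw [Matrix.single_apply, if_neg]
      rintro ⟨-, rfl⟩
      exact hb rfl
    · simp
  · rw [if_neg h, Finset.sum_eq_zero]
    intro b _
    rw [Matrix.single_apply, if_neg]
    rintro ⟨rfl, rfl⟩
    exact h rfl

lemma I_smul_controlR_eq (r : ℕ) :
    Complex.I • controlR r = ∑ k : Fin r, hop k (Complex.I * (amp r k : ℂ)) := by
  rw [controlR_eq, compress_driveAdj, compress_drive_eq_sum, Matrix.conjTranspose_sum,
    ← Finset.sum_add_distrib, Finset.smul_sum]
  refine Finset.sum_congr rfl fun k _ => ?_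
  ext a b
  simp only [hop, skew, Matrix.conjTranspose_single, Matrix.smul_apply, Matrix.add_apply,
    Matrix.sub_apply, Matrix.single_apply, smul_eq_mul, Complex.star_def, map_mul, Complex.conj_I,
    Complex.conj_ofReal, mul_add, mul_ite, mul_zero]
  split_ifs <;> ring

lemma trace_compress_drive (r : ℕ) : (compress r (drive r)).trace = 0 :=
  Finset.sum_eq_zero fun k _ => by
    rw [Matrix.diag_apply, compress_drive_apply, if_neg (by omega)]

lemma controlR_mem_su (r : ℕ) : Complex.I • controlR r ∈ su (r + 1) := by
  rw [controlR_eq, compress_driveAdj]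
  constructor
  · simp [add_comm]
  · rw [Matrix.trace_smul, Matrix.trace_add, Matrix.trace_conjTranspose, trace_compress_drive,
      star_zero, add_zero, smul_zero]

lemma controlI_mem_su (r : ℕ) : Complex.I • controlI r ∈ su (r + 1) := by
  rw [controlI_eq, compress_driveAdj]
  constructor
  · simp [smul_smul, smul_sub]
  · rw [Matrix.trace_smul, Matrix.trace_sub, Matrix.trace_smul, Matrix.trace_smul,
      Matrix.trace_conjTranspose, trace_compress_drive]
    simp

lemma lieSpan_lie_controlR {r : ℕ} (hr : 1 ≤ r) :
    LieSubalgebra.lieSpan ℝ (Op r)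
      {⁅Complex.I • controlR r, Complex.I • controlI r⁆, Complex.I • controlR r} = su (r + 1) := by
  apply le_antisymm
  · rw [LieSubalgebra.lieSpan_le]
    rintro A (rfl | rfl)
    · exact (su (r + 1)).lie_mem (controlR_mem_su r) (controlI_mem_su r)
    · exact controlR_mem_su r
  · refine su_le_of_hop_mem (hop_mem hr (E := level r) ?_
      (z := fun k => Complex.I * (amp r k : ℂ)) ?_ ?_
      (anharmonic_level_zero hr ⟨0, hr⟩).1 fun k => (anharmonic_level_zero hr k).2)
    · rw [← lie_controlR_controlI]
      exact LieSubalgebra.subset_lieSpan (Set.mem_insert _ _)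
    · intro k
      have := amp_ne_zero k.2
      simp [this]
    · rw [← I_smul_controlR_eq]
      exact LieSubalgebra.subset_lieSpan (Set.mem_insert_of_mem _ rfl)

lemma lieSpan_controlR_controlI {r : ℕ} (hr : 1 ≤ r) :
    LieSubalgebra.lieSpan ℝ (Op r)
      {Complex.I • controlR r, Complex.I • controlI r} = su (r + 1) := by
  apply le_antisymm
  · rw [LieSubalgebra.lieSpan_le]
    rintro A (rfl | rfl)
    · exact controlR_mem_su r
    · exact controlI_mem_su r
  · rw [← lieSpan_lie_controlR hr, LieSubalgebra.lieSpan_le]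
    have hR : Complex.I • controlR r ∈ LieSubalgebra.lieSpan ℝ (Op r)
        {Complex.I • controlR r, Complex.I • controlI r} :=
      LieSubalgebra.subset_lieSpan (Set.mem_insert _ _)
    have hI : Complex.I • controlI r ∈ LieSubalgebra.lieSpan ℝ (Op r)
        {Complex.I • controlR r, Complex.I • controlI r} :=
      LieSubalgebra.subset_lieSpan (Set.mem_insert_of_mem _ rfl)
    rintro A (rfl | rfl)
    · exact LieSubalgebra.lie_mem _ hR hI
    · exact hR

/-! ### Exponentials in `SU(N)` -/

section SpectralLog

open scoped Matrix.Norms.L2Operator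

variable {n : Type*} [Fintype n] [DecidableEq n]

/-- Every unitary matrix is the exponential of a skew-Hermitian one. -/
lemma exists_isHermitian_exp_eq {V : Matrix n n ℂ} (hV : V ∈ Matrix.unitaryGroup n ℂ) :
    ∃ H : Matrix n n ℂ, H.IsHermitian ∧ NormedSpace.exp (Complex.I • H) = V := by
  have hn : IsStarNormal V := ⟨by
    rw [Commute, SemiconjBy, (Unitary.mem_iff.1 hV).1, (Unitary.mem_iff.1 hV).2]⟩
  -- The spectrum is finite, so the jump of `arg` on the negative axis does no harm to the
  -- functional calculus.
  have hc : ∀ f : ℂ → ℂ, ContinuousOn f (spectrum ℂ V) := fun f =>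
    (Matrix.finite_spectrum V).continuousOn f
  refine ⟨cfc (fun z : ℂ => (Complex.arg z : ℂ)) V, IsSelfAdjoint.cfc_arg V, ?_⟩
  rw [← cfc_smul Complex.I _ V (hc _), ← CFC.complex_exp_eq_normedSpace_exp,
    ← cfc_comp' Complex.exp _ V (Complex.continuous_exp.continuousOn) (hc _)]
  conv_rhs => rw [← cfc_id' ℂ V]
  refine cfc_congr fun z hz => ?_
  have hz1 : ‖z‖ = 1 := spectrum.norm_eq_one_of_unitary hV hz
  have := Complex.norm_mul_exp_arg_mul_I z
  rw [hz1, Complex.ofReal_one, one_mul] at this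
  simpa [mul_comm] using this

end SpectralLog

variable {n : Type*} [Fintype n] [DecidableEq n]

lemma exp_I_smul_mem_unitaryGroup {H : Matrix n n ℂ} (hH : H.IsHermitian) :
    NormedSpace.exp (Complex.I • H) ∈ Matrix.unitaryGroup n ℂ := by
  rw [Matrix.mem_unitaryGroup_iff, Matrix.star_eq_conjTranspose, ← Matrix.exp_conjTranspose,
    Matrix.conjTranspose_smul, hH.eq, Complex.star_def, Complex.conj_I, neg_smul,
    ← Matrix.exp_add_of_commute _ _ (Commute.refl (Complex.I • H)).neg_right, add_neg_cancel,
    NormedSpace.exp_zero]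

lemma det_exp_I_smul {H : Matrix n n ℂ} (hH : H.IsHermitian) :
    (NormedSpace.exp (Complex.I • H)).det = Complex.exp (Complex.I * H.trace) := by
  set U := hH.eigenvectorUnitary
  have hU : (U : Matrix n n ℂ) * star (U : Matrix n n ℂ) = 1 := (Unitary.mem_iff.1 U.2).2
  have hUu : IsUnit (U : Matrix n n ℂ) := ⟨⟨U, star (U : Matrix n n ℂ), hU,
    (Unitary.mem_iff.1 U.2).1⟩, rfl⟩
  have hinv : (U : Matrix n n ℂ)⁻¹ = star (U : Matrix n n ℂ) := Matrix.inv_eq_right_inv hU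
  have h : Complex.I • H = (U : Matrix n n ℂ) *
      Matrix.diagonal (fun i => Complex.I * (hH.eigenvalues i : ℂ)) * (U : Matrix n n ℂ)⁻¹ := by
    conv_lhs => rw [hH.spectral_theorem, Unitary.conjStarAlgAut_apply]
    rw [hinv, ← smul_mul_assoc, ← mul_smul_comm, ← Matrix.diagonal_smul]
    rfl
  rw [h, Matrix.exp_conj _ _ hUu, Matrix.exp_diagonal, Matrix.det_mul_comm, ← mul_assoc,
    Matrix.nonsing_inv_mul _ ((Matrix.isUnit_iff_isUnit_det _).1 hUu), one_mul, Matrix.det_diagonal,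
    hH.trace_eq_sum_eigenvalues, Finset.mul_sum, Complex.exp_sum]
  refine Finset.prod_congr rfl fun i _ => ?_
  rw [Pi.coe_exp, Complex.exp_eq_exp_ℂ]
  rfl

lemma isHermitian_neg_I_smul {m : Type*} {A : Matrix m m ℂ} (hA : Aᴴ = -A) :
    (-Complex.I • A).IsHermitian := by
  rw [Matrix.IsHermitian, Matrix.conjTranspose_smul, hA]
  simp

lemma exp_mem_specialUnitaryGroup {N : ℕ} {A : Matrix (Fin N) (Fin N) ℂ} (hA : A ∈ su N) :
    NormedSpace.exp A ∈ Matrix.specialUnitaryGroup (Fin N) ℂ := by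
  have h : A = Complex.I • (-Complex.I • A) := by
    rw [smul_smul, mul_neg, Complex.I_mul_I, neg_neg, one_smul]
  have hH := isHermitian_neg_I_smul hA.1
  rw [h, Matrix.mem_specialUnitaryGroup_iff, det_exp_I_smul hH]
  refine ⟨exp_I_smul_mem_unitaryGroup hH, ?_⟩
  rw [Matrix.trace_smul, hA.2, smul_zero, mul_zero, Complex.exp_zero]

/-- A Hermitian logarithm `H` of `V` has trace `2πk`, perhaps nonzero. With `θ = 2πk/(r+1)` the
scalar `e^{iθ}` is split off; it is also the exponential of the traceless matrix `iθ diag(-r, 1, …,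
1)`, since `e^{-irθ} = e^{iθ}`. -/
lemma exists_exp_mul_exp_eq {r : ℕ} {V : Op r}
    (hV : V ∈ Matrix.specialUnitaryGroup (Fin (r + 1)) ℂ) :
    ∃ A ∈ su (r + 1), ∃ B ∈ su (r + 1), NormedSpace.exp A * NormedSpace.exp B = V := by
  rw [Matrix.mem_specialUnitaryGroup_iff] at hV
  obtain ⟨H, hH, rfl⟩ := exists_isHermitian_exp_eq hV.1
  have hdet := hV.2
  rw [det_exp_I_smul hH, Complex.exp_eq_one_iff] at hdet
  obtain ⟨k, hk⟩ := hdet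
  have htr : H.trace = 2 * Real.pi * k := by
    have : Complex.I * (H.trace - 2 * Real.pi * k) = 0 := by linear_combination hk
    exact sub_eq_zero.1 ((mul_eq_zero.1 this).resolve_left Complex.I_ne_zero)
  set θ : ℝ := 2 * Real.pi * k / (r + 1) with hθ
  have hθ' : (θ : ℂ) * (r + 1) = 2 * Real.pi * k := by
    have : (r + 1 : ℂ) ≠ 0 := by exact_mod_cast Nat.succ_ne_zero r
    rw [hθ]
    push_cast
    field_simp
  set D : Op r := Matrix.diagonal fun i => Complex.I * θ * (if i = 0 then -(r : ℂ) else 1) with hD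
  have hexpD : NormedSpace.exp D = NormedSpace.exp ((Complex.I * θ) • (1 : Op r)) := by
    rw [hD, ← Matrix.diagonal_one, ← Matrix.diagonal_smul, Matrix.exp_diagonal,
      Matrix.exp_diagonal]
    congr 1
    funext i
    rw [Pi.coe_exp, Pi.coe_exp, ← Complex.exp_eq_exp_ℂ]
    simp only [Pi.smul_apply, smul_eq_mul, mul_one]
    split_ifs with h
    · rw [Complex.exp_eq_exp_iff_exists_int]
      refine ⟨-k, ?_⟩
      push_cast
      linear_combination -Complex.I * hθ'
    · rw [mul_one]
  refine ⟨Complex.I • H - (Complex.I * θ) • 1, ⟨?_, ?_⟩, D, ⟨?_, ?_⟩, ?_⟩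
  · rw [Matrix.conjTranspose_sub, Matrix.conjTranspose_smul, Matrix.conjTranspose_smul, hH.eq,
      Matrix.conjTranspose_one, star_mul', Complex.star_def, Complex.conj_I, Complex.conj_ofReal]
    module
  · rw [Matrix.trace_sub, Matrix.trace_smul, Matrix.trace_smul, Matrix.trace_one, htr]
    simp
    linear_combination -Complex.I * hθ'
  · rw [hD, Matrix.diagonal_conjTranspose, Matrix.diagonal_neg]
    congr 1
    funext i
    simp only [Pi.star_apply]
    split_ifs <;> simp
  · rw [hD, Matrix.trace_diagonal, ← Finset.mul_sum, Fin.sum_univ_succ]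
    simp [Fin.succ_ne_zero]
  · rw [hexpD, ← Matrix.exp_add_of_commute, sub_add_cancel]
    exact ((Commute.one_right _).smul_right _)

/-! ### One-parameter subgroups of a Banach algebra -/

section BanachAlgebra

lemma deriv_mem_of_forall_mem {E : Type*} [NormedAddCommGroup E] [NormedSpace ℝ E]
    [FiniteDimensional ℝ E] {W : Submodule ℝ E} {f : ℝ → E} {f' : E} {x : ℝ}
    (hf : HasDerivAt f f' x) (h : ∀ t, f t ∈ W) : f' ∈ W := by
  refine W.closed_of_finiteDimensional.mem_of_tendsto
    (hasDerivAt_iff_tendsto_slope.1 hf) (Filter.Eventually.of_forall fun t => ?_)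
  rw [slope_def_module]
  exact W.smul_mem _ (W.sub_mem (h t) (h x))

variable {𝔸 : Type*} [NormedRing 𝔸] [NormedAlgebra ℝ 𝔸] [CompleteSpace 𝔸]

lemma hasStrictDerivAt_exp_smul_zero (A : 𝔸) :
    HasStrictDerivAt (fun s : ℝ => NormedSpace.exp (s • A)) A 0 := by
  simpa using hasStrictDerivAt_exp_smul_const (𝕂 := ℝ) A (0 : ℝ)

lemma hasDerivAt_exp_conj (A w : 𝔸) :
    HasDerivAt (fun s : ℝ => NormedSpace.exp (s • A) * w * NormedSpace.exp (s • -A))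
      (A * w - w * A) 0 := by
  have h1 := (hasStrictDerivAt_exp_smul_zero A).hasDerivAt
  have h2 := (hasStrictDerivAt_exp_smul_zero (-A)).hasDerivAt
  refine ((h1.mul_const w).mul h2).congr_deriv ?_
  simp [sub_eq_add_neg]

/-- Products of one-parameter groups have the obvious derivative at the origin. -/
lemma exists_hasStrictFDerivAt_prod_exp {ι : Type*} [Fintype ι] [DecidableEq ι]
    {P : Submonoid 𝔸} (B : ι → 𝔸) (hB : ∀ i, ∀ s : ℝ, NormedSpace.exp (s • B i) ∈ P)
    (t : Finset ι) :
    ∃ f : (ι → ℝ) → 𝔸, f 0 = 1 ∧ (∀ s, f s ∈ P) ∧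
      HasStrictFDerivAt f
        (∑ i ∈ t, (ContinuousLinearMap.proj i : (ι → ℝ) →L[ℝ] ℝ).smulRight (B i)) 0 := by
  induction t using Finset.induction_on with
  | empty =>
    exact ⟨fun _ => 1, rfl, fun _ => one_mem _, by
      simpa using hasStrictFDerivAt_const (1 : 𝔸) (0 : ι → ℝ)⟩
  | insert a t ha ih =>
    obtain ⟨f, hf0, hfP, hf⟩ := ih
    refine ⟨fun s => NormedSpace.exp (s a • B a) * f s, by simp [hf0],
      fun s => mul_mem (hB a _) (hfP s), ?_⟩
    have h2 : HasStrictFDerivAt (fun s : ι → ℝ => s a)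
        (ContinuousLinearMap.proj a : (ι → ℝ) →L[ℝ] ℝ) 0 :=
      (ContinuousLinearMap.proj a : (ι → ℝ) →L[ℝ] ℝ).hasStrictFDerivAt
    have h3 := ((hasStrictDerivAt_exp_smul_zero (B a)).hasStrictFDerivAt
      (x := (fun s : ι → ℝ => s a) 0)).comp (0 : ι → ℝ) h2
    refine (h3.mul' hf).congr_fderiv ?_
    ext v : 1
    rw [Finset.sum_insert ha]
    simp [hf0, add_comm]

/-- If the generators `B i`, a complement `Q` and a direction `J` span the algebra, then elements
near `1` factor through a product of the one-parameter groups of the `B i`. -/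
lemma eventually_exists_factorization [FiniteDimensional ℝ 𝔸] {ι : Type*} [Fintype ι]
    {P : Submonoid 𝔸} (B : ι → 𝔸) (hB : ∀ i, ∀ s : ℝ, NormedSpace.exp (s • B i) ∈ P)
    (Q : Submodule ℝ 𝔸) (J : 𝔸)
    (hspan : ∀ Z : 𝔸, ∃ s : ι → ℝ, ∃ h ∈ Q, ∃ θ : ℝ, ∑ i, s i • B i + (h + θ • J) = Z)
    {ε : ℝ} (hε : 0 < ε) :
    ∀ᶠ V in 𝓝 (1 : 𝔸), ∃ p ∈ P, ∃ h ∈ Q, IsUnit (2 + h) ∧ ∃ θ : ℝ, |θ| < ε ∧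
      V = p * ((1 + h) * NormedSpace.exp (θ • J)) := by
  classical
  obtain ⟨f, hf0, hfP, hf⟩ := exists_hasStrictFDerivAt_prod_exp B hB Finset.univ
  set F : (ι → ℝ) →L[ℝ] 𝔸 :=
    ∑ i, (ContinuousLinearMap.proj i : (ι → ℝ) →L[ℝ] ℝ).smulRight (B i) with hF
  let Ψ : (ι → ℝ) × Q × ℝ → 𝔸 :=
    fun x => f x.1 * ((1 + (x.2.1 : 𝔸)) * NormedSpace.exp (x.2.2 • J))
  have hΨ0 : Ψ 0 = 1 := by simp [Ψ, hf0]
  let p1 : (ι → ℝ) × Q × ℝ →L[ℝ] (ι → ℝ) := ContinuousLinearMap.fst ℝ _ _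
  let p2 : (ι → ℝ) × Q × ℝ →L[ℝ] 𝔸 :=
    Q.subtypeL.comp ((ContinuousLinearMap.fst ℝ _ _).comp (ContinuousLinearMap.snd ℝ _ _))
  let p3 : (ι → ℝ) × Q × ℝ →L[ℝ] ℝ :=
    (ContinuousLinearMap.snd ℝ _ _).comp (ContinuousLinearMap.snd ℝ _ _)
  let Ψ' : (ι → ℝ) × Q × ℝ →L[ℝ] 𝔸 := F.comp p1 + (p2 + p3.smulRight J)
  have hΨ : HasStrictFDerivAt Ψ Ψ' 0 := by
    have h1 : HasStrictFDerivAt (fun x : (ι → ℝ) × Q × ℝ => f x.1) (F.comp p1) 0 :=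
      HasStrictFDerivAt.comp (0 : (ι → ℝ) × Q × ℝ) (g := f) (f := p1) hf p1.hasStrictFDerivAt
    have h2 : HasStrictFDerivAt (fun x : (ι → ℝ) × Q × ℝ => 1 + (x.2.1 : 𝔸)) p2 0 :=
      p2.hasStrictFDerivAt.const_add 1
    have h3 := ((hasStrictDerivAt_exp_smul_zero J).hasStrictFDerivAt (x := p3 0)).comp
      (0 : (ι → ℝ) × Q × ℝ) p3.hasStrictFDerivAt
    refine (h1.mul' (h2.mul' h3)).congr_fderiv ?_
    refine ContinuousLinearMap.ext fun v => ?_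
    simp [Ψ', hf0, p3]
    abel
  have hsurj : Ψ'.range = ⊤ := by
    rw [LinearMap.range_eq_top]
    intro Z
    obtain ⟨s, h, hh, θ, rfl⟩ := hspan Z
    exact ⟨(s, ⟨h, hh⟩, θ), by simp [Ψ', p1, p2, p3, hF]⟩
  -- Surjectivity of the derivative suffices, so the `B i` may be linearly dependent.
  have hmap := hΨ.map_nhds_eq_of_surj hsurj
  rw [hΨ0] at hmap
  have hU : ∀ᶠ x : (ι → ℝ) × Q × ℝ in 𝓝 0, IsUnit (2 + (x.2.1 : 𝔸)) ∧ |x.2.2| < ε := by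
    refine Filter.Eventually.and ?_ ?_
    · have hc : ContinuousAt (fun x : (ι → ℝ) × Q × ℝ => 2 + (x.2.1 : 𝔸)) 0 := by fun_prop
      refine hc.eventually (Units.isOpen.mem_nhds ?_)
      have : IsUnit (algebraMap ℝ 𝔸 2) := (isUnit_iff_ne_zero.2 two_ne_zero).map _
      rw [map_ofNat] at this
      simpa using this
    · have hc : ContinuousAt (fun x : (ι → ℝ) × Q × ℝ => |x.2.2|) 0 := by fun_prop
      exact hc.eventually (gt_mem_nhds (by simpa using hε))
  rw [← hmap, Filter.eventually_map]
  filter_upwards [hU] with x hx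
  exact ⟨f x.1, hfP _, x.2.1, x.2.1.2, hx.1, x.2.2, hx.2, rfl⟩

end BanachAlgebra

/-! ### Groups generated by one-parameter subgroups -/

section Orbit

open scoped Matrix.Norms.Operator

variable {N : ℕ}

/-- The elements of `SU(N)` which belong to `M` together with their inverses. -/
def symmetricPart (M : Submonoid (Matrix (Fin N) (Fin N) ℂ)) :
    Submonoid (Matrix (Fin N) (Fin N) ℂ) where
  carrier := {g | g ∈ Matrix.specialUnitaryGroup (Fin N) ℂ ∧ g ∈ M ∧ star g ∈ M}
  one_mem' := ⟨one_mem _, one_mem _, by rw [star_one]; exact one_mem _⟩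
  mul_mem' := by
    rintro g h ⟨hg, hg1, hg2⟩ ⟨hh, hh1, hh2⟩
    exact ⟨mul_mem hg hh, mul_mem hg1 hh1, by rw [star_mul]; exact mul_mem hh2 hg2⟩

/-- The real span of the conjugates of `S` by `symmetricPart M`. -/
noncomputable def orbitSpan (M : Submonoid (Matrix (Fin N) (Fin N) ℂ)) (S : Set (Matrix (Fin N) (Fin N) ℂ)) :
    Submodule ℝ (Matrix (Fin N) (Fin N) ℂ) :=
  Submodule.span ℝ {B | ∃ g ∈ symmetricPart M, ∃ A ∈ S, B = g * A * star g}

lemma star_exp_smul {A : Matrix (Fin N) (Fin N) ℂ} (hA : A ∈ su N) (s : ℝ) :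
    star (NormedSpace.exp (s • A)) = NormedSpace.exp (-s • A) := by
  rw [Matrix.star_eq_conjTranspose, ← Matrix.exp_conjTranspose, Matrix.conjTranspose_smul, hA.1,
    star_trivial, smul_neg, neg_smul]

lemma star_mul_self_of_mem {g : Matrix (Fin N) (Fin N) ℂ}
    (hg : g ∈ Matrix.specialUnitaryGroup (Fin N) ℂ) : star g * g = 1 :=
  Matrix.mem_unitaryGroup_iff'.1 hg.1

lemma star_mem_specialUnitaryGroup {g : Matrix (Fin N) (Fin N) ℂ}
    (hg : g ∈ Matrix.specialUnitaryGroup (Fin N) ℂ) :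
    star g ∈ Matrix.specialUnitaryGroup (Fin N) ℂ := by
  refine ⟨Unitary.star_mem hg.1, ?_⟩
  change (star g).det = 1
  rw [Matrix.star_eq_conjTranspose, Matrix.det_conjTranspose, show g.det = 1 from hg.2, star_one]

variable {M : Submonoid (Matrix (Fin N) (Fin N) ℂ)} {S : Set (Matrix (Fin N) (Fin N) ℂ)}

lemma exp_mem_symmetricPart (hS : ∀ A ∈ S, A ∈ su N)
    (hM : ∀ A ∈ S, ∀ s : ℝ, NormedSpace.exp (s • A) ∈ M) {A : Matrix (Fin N) (Fin N) ℂ}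
    (hA : A ∈ S) (s : ℝ) : NormedSpace.exp (s • A) ∈ symmetricPart M :=
  ⟨exp_mem_specialUnitaryGroup ((su N).smul_mem s (hS A hA)), hM A hA s, by
    rw [star_exp_smul (hS A hA)]; exact hM A hA (-s)⟩

lemma conj_mem_orbitSpan {g w : Matrix (Fin N) (Fin N) ℂ} (hg : g ∈ symmetricPart M)
    (hw : w ∈ orbitSpan M S) : g * w * star g ∈ orbitSpan M S := by
  induction hw using Submodule.span_induction with
  | mem x hx =>
    obtain ⟨h, hh, A, hA, rfl⟩ := hx
    exact Submodule.subset_span ⟨g * h, mul_mem hg hh, A, hA, by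
      rw [star_mul]; simp only [mul_assoc]⟩
  | zero => simp
  | add x y _ _ hx hy => rw [mul_add, add_mul]; exact add_mem hx hy
  | smul c x _ hx =>
    rw [mul_smul_comm, smul_mul_assoc]
    exact Submodule.smul_mem _ c hx

/-- The bracket is the derivative at `0` of `e^{sA} w e^{-sA}`, a curve inside the span, and
finite-dimensional subspaces are closed. -/
lemma lie_mem_orbitSpan (hS : ∀ A ∈ S, A ∈ su N)
    (hM : ∀ A ∈ S, ∀ s : ℝ, NormedSpace.exp (s • A) ∈ M) {A w : Matrix (Fin N) (Fin N) ℂ}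
    (hA : A ∈ S) (hw : w ∈ orbitSpan M S) : ⁅A, w⁆ ∈ orbitSpan M S := by
  refine deriv_mem_of_forall_mem (hasDerivAt_exp_conj A w) fun s => ?_
  have := conj_mem_orbitSpan (exp_mem_symmetricPart hS hM hA s) hw
  rwa [star_exp_smul (hS A hA), neg_smul, ← smul_neg] at this

/-- By the Jacobi identity, the elements of the orbit span whose brackets preserve it form a Lie
subalgebra, and this subalgebra contains `S`. -/
lemma lieSpan_le_orbitSpan (hS : ∀ A ∈ S, A ∈ su N)
    (hM : ∀ A ∈ S, ∀ s : ℝ, NormedSpace.exp (s • A) ∈ M) {A : Matrix (Fin N) (Fin N) ℂ}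
    (hA : A ∈ LieSubalgebra.lieSpan ℝ (Matrix (Fin N) (Fin N) ℂ) S) : A ∈ orbitSpan M S := by
  let K : LieSubalgebra ℝ (Matrix (Fin N) (Fin N) ℂ) :=
    { carrier := {B | B ∈ orbitSpan M S ∧ ∀ w ∈ orbitSpan M S, ⁅B, w⁆ ∈ orbitSpan M S}
      add_mem' := fun {B C} hB hC => ⟨add_mem hB.1 hC.1, fun w hw => by
        rw [add_lie]; exact add_mem (hB.2 w hw) (hC.2 w hw)⟩
      zero_mem' := ⟨zero_mem _, fun w _ => by rw [zero_lie]; exact zero_mem _⟩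
      smul_mem' := fun c B hB => ⟨Submodule.smul_mem _ c hB.1, fun w hw => by
        rw [smul_lie]; exact Submodule.smul_mem _ c (hB.2 w hw)⟩
      lie_mem' := fun {B C} hB hC => ⟨hB.2 C hC.1, fun w hw => by
        rw [lie_lie]
        exact sub_mem (hB.2 _ (hC.2 w hw)) (hC.2 _ (hB.2 w hw))⟩ }
  have hK : LieSubalgebra.lieSpan ℝ (Matrix (Fin N) (Fin N) ℂ) S ≤ K := by
    rw [LieSubalgebra.lieSpan_le]
    intro B hB
    exact ⟨Submodule.subset_span ⟨1, one_mem _, B, hB, by simp⟩,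
      fun w hw => lie_mem_orbitSpan hS hM hB hw⟩
  exact (hK hA).1

/-- The one-parameter group of a conjugate of an element of `S` stays in `symmetricPart M`. -/
lemma exp_conj_mem_symmetricPart (hS : ∀ A ∈ S, A ∈ su N)
    (hM : ∀ A ∈ S, ∀ s : ℝ, NormedSpace.exp (s • A) ∈ M) {g A : Matrix (Fin N) (Fin N) ℂ}
    (hg : g ∈ symmetricPart M) (hA : A ∈ S) (s : ℝ) :
    NormedSpace.exp (s • (g * A * star g)) ∈ symmetricPart M := by
  have h1 : star g * g = 1 := star_mul_self_of_mem hg.1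
  have h2 : g * star g = 1 := Matrix.mem_unitaryGroup_iff.1 hg.1.1
  have hU : IsUnit g := ⟨⟨g, star g, h2, h1⟩, rfl⟩
  have hinv : g⁻¹ = star g := Matrix.inv_eq_right_inv h2
  have h3 : s • (g * A * star g) = g * (s • A) * g⁻¹ := by
    rw [hinv, mul_smul_comm, smul_mul_assoc]
  have hstar : star g ∈ symmetricPart M :=
    ⟨star_mem_specialUnitaryGroup hg.1, hg.2.2, by rw [star_star]; exact hg.2.1⟩
  rw [h3, Matrix.exp_conj _ _ hU, hinv]
  exact mul_mem (mul_mem hg (exp_mem_symmetricPart hS hM hA s)) hstar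

/-- The finite spanning set is drawn from the conjugates themselves, because their one-parameter
groups are the ones known to lie in `M`. -/
lemma exists_finset_orbitSpan_eq (M : Submonoid (Matrix (Fin N) (Fin N) ℂ))
    (S : Set (Matrix (Fin N) (Fin N) ℂ)) :
    ∃ t : Finset (Matrix (Fin N) (Fin N) ℂ),
      (∀ B ∈ t, ∃ g ∈ symmetricPart M, ∃ A ∈ S, B = g * A * star g) ∧
      ∀ Z ∈ orbitSpan M S, ∃ s : t → ℝ, ∑ i, s i • (i : Matrix (Fin N) (Fin N) ℂ) = Z := by
  obtain ⟨t, ht, hspan⟩ := (Submodule.fg_span_iff_fg_span_finset_subset _).1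
    (IsNoetherian.noetherian (orbitSpan M S))
  refine ⟨t, fun B hB => ht hB, fun Z hZ => ?_⟩
  rw [orbitSpan, hspan] at hZ
  obtain ⟨c, hc⟩ := Submodule.mem_span_finset'.1 hZ
  exact ⟨c, hc⟩

/-- The Hermitian matrices, as a real subspace. -/
noncomputable def hermitian (N : ℕ) : Submodule ℝ (Matrix (Fin N) (Fin N) ℂ) where
  carrier := {A | star A = A}
  add_mem' := fun {A B} hA hB => by
    change star (A + B) = A + B
    rw [star_add, show star A = A from hA, show star B = B from hB]
  zero_mem' := star_zero _
  smul_mem' := fun c A hA => by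
    change star (c • A) = c • A
    rw [star_smul, show star A = A from hA, star_trivial]

/-- Splitting into skew and Hermitian parts; `θ = Im tr Z / N` absorbs the trace of the skew part.
This gives the directions transverse to `SU(N)`. -/
lemma exists_su_add_hermitian [NeZero N] (Z : Matrix (Fin N) (Fin N) ℂ) :
    ∃ A ∈ su N, ∃ h ∈ hermitian N, ∃ θ : ℝ,
      A + (h + θ • (Complex.I • (1 : Matrix (Fin N) (Fin N) ℂ))) = Z := by
  have hN : (N : ℂ) ≠ 0 := by exact_mod_cast NeZero.ne N
  set θ : ℝ := Z.trace.im / N with hθ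
  have hθN : (θ : ℂ) * N = Z.trace.im := by
    rw [hθ]
    push_cast
    field_simp
  refine ⟨(1 / 2 : ℝ) • (Z - Zᴴ) - θ • (Complex.I • 1), ⟨?_, ?_⟩, (1 / 2 : ℝ) • (Z + Zᴴ), ?_, θ, ?_⟩
  · rw [Matrix.conjTranspose_sub, Matrix.conjTranspose_smul, Matrix.conjTranspose_smul,
      Matrix.conjTranspose_sub, Matrix.conjTranspose_conjTranspose, Matrix.conjTranspose_smul,
      Matrix.conjTranspose_one, Complex.star_def, Complex.conj_I, star_trivial, star_trivial]
    module
  · rw [Matrix.trace_sub, Matrix.trace_smul, Matrix.trace_smul, Matrix.trace_sub,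
      Matrix.trace_smul, Matrix.trace_one, Matrix.trace_conjTranspose, Fintype.card_fin]
    have h1 : Z.trace - star Z.trace = 2 * Z.trace.im * Complex.I := by
      rw [Complex.star_def, Complex.sub_conj]
      push_cast
      ring
    rw [h1, Complex.real_smul, Complex.real_smul, smul_eq_mul]
    push_cast
    linear_combination -Complex.I * hθN
  · change star ((1 / 2 : ℝ) • (Z + Zᴴ)) = (1 / 2 : ℝ) • (Z + Zᴴ)
    rw [star_smul, star_trivial, star_add, ← Matrix.star_eq_conjTranspose, star_star, add_comm]
  · module

/-- Unitarity gives `(1+h)² = 1`, that is `(2+h)h = 0`, hence `h = 0`. The determinant then puts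
`Nθ` in `2πℤ`, and `|Nθ| < 1` leaves only `θ = 0`. -/
lemma eq_one_of_factor {h : Matrix (Fin N) (Fin N) ℂ} (hN : N ≠ 0) (hh : h ∈ hermitian N)
    (hu : IsUnit (2 + h)) {θ : ℝ} (hθ : |θ| < 1 / N)
    (hSU : (1 + h) * NormedSpace.exp (θ • (Complex.I • (1 : Matrix (Fin N) (Fin N) ℂ))) ∈
      Matrix.specialUnitaryGroup (Fin N) ℂ) :
    (1 + h) * NormedSpace.exp (θ • (Complex.I • (1 : Matrix (Fin N) (Fin N) ℂ))) = 1 := by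
  have hh' : star h = h := hh
  set E := NormedSpace.exp (θ • (Complex.I • (1 : Matrix (Fin N) (Fin N) ℂ))) with hE
  have hEd : E = Matrix.diagonal fun _ => Complex.exp (θ * Complex.I) := by
    have : θ • (Complex.I • (1 : Matrix (Fin N) (Fin N) ℂ)) =
        Matrix.diagonal fun _ => (θ * Complex.I : ℂ) := by
      rw [← Matrix.diagonal_one, ← Matrix.diagonal_smul, ← Matrix.diagonal_smul]
      congr 1
      funext i
      simp
    rw [hE, this, Matrix.exp_diagonal]
    congr 1
    funext i
    rw [Pi.coe_exp, Complex.exp_eq_exp_ℂ]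
  have hEs : E * star E = 1 := by
    rw [hEd, Matrix.star_eq_conjTranspose, Matrix.diagonal_conjTranspose,
      Matrix.diagonal_mul_diagonal, ← Matrix.diagonal_one]
    congr 1
    funext i
    rw [Pi.star_apply, Complex.star_def, ← Complex.exp_conj, ← Complex.exp_add]
    simp
  have h0 : h = 0 := by
    have h1 := Matrix.mem_unitaryGroup_iff.1 hSU.1
    rw [star_mul, star_add, star_one, hh', mul_assoc, ← mul_assoc E, hEs, one_mul] at h1
    have h2 : (2 + h) * h = 0 := by
      have : (1 + h) * (1 + h) = 1 + (2 + h) * h := by noncomm_ring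
      rwa [this, add_eq_left] at h1
    exact (hu.mul_right_eq_zero).1 h2
  have hdet : E.det = 1 := by
    have := hSU.2
    rwa [h0, add_zero, one_mul] at this
  rw [hEd, Matrix.det_diagonal, Finset.prod_const, Finset.card_univ, Fintype.card_fin,
    ← Complex.exp_nat_mul, Complex.exp_eq_one_iff] at hdet
  obtain ⟨k, hk⟩ := hdet
  have hNθ : (N : ℝ) * θ = k * (2 * Real.pi) := by
    have : Complex.I * ((N : ℂ) * θ - k * (2 * Real.pi)) = 0 := by linear_combination hk
    have := sub_eq_zero.1 ((mul_eq_zero.1 this).resolve_left Complex.I_ne_zero)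
    exact_mod_cast this
  have hNpos : (0 : ℝ) < N := by exact_mod_cast Nat.pos_of_ne_zero hN
  have hlt : |(N : ℝ) * θ| < 1 := by
    rw [abs_mul, abs_of_pos hNpos]
    rwa [lt_div_iff₀ hNpos, mul_comm] at hθ
  have hk0 : k = 0 := by
    by_contra hk0
    have h1 : (1 : ℝ) ≤ |(k : ℝ)| := by exact_mod_cast Int.one_le_abs hk0
    rw [hNθ, abs_mul, abs_of_pos Real.two_pi_pos] at hlt
    nlinarith [Real.pi_gt_three]
  have hθ0 : θ = 0 := by
    rw [hk0, Int.cast_zero, zero_mul] at hNθ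
    exact (mul_eq_zero.1 hNθ).resolve_left hNpos.ne'
  rw [h0, add_zero, one_mul, hE, hθ0, zero_smul, NormedSpace.exp_zero]

/-- The factorization is made in the full matrix algebra. For `V` in `SU(N)` the transverse factor
also lies in `SU(N)`, so it is trivial and `V` equals the product of one-parameter elements. -/
lemma eventually_mem_of_lieSpan_eq [NeZero N]
    (hspan : LieSubalgebra.lieSpan ℝ (Matrix (Fin N) (Fin N) ℂ) S = su N)
    (hM : ∀ A ∈ S, ∀ s : ℝ, NormedSpace.exp (s • A) ∈ M) :
    ∀ᶠ V in 𝓝 (1 : Matrix (Fin N) (Fin N) ℂ),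
      V ∈ Matrix.specialUnitaryGroup (Fin N) ℂ → V ∈ M := by
  have hS : ∀ A ∈ S, A ∈ su N := fun A hA => hspan ▸ LieSubalgebra.subset_lieSpan hA
  obtain ⟨t, ht, hts⟩ := exists_finset_orbitSpan_eq M S
  have hB : ∀ (i : t) (s : ℝ),
      NormedSpace.exp (s • (i : Matrix (Fin N) (Fin N) ℂ)) ∈ symmetricPart M := by
    intro i s
    obtain ⟨g, hg, A, hA, h⟩ := ht i i.2
    rw [h]
    exact exp_conj_mem_symmetricPart hS hM hg hA s
  have hN : (0 : ℝ) < 1 / N := by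
    have := Nat.pos_of_ne_zero (NeZero.ne N)
    positivity
  have hdec := eventually_exists_factorization (fun i : t => (i : Matrix (Fin N) (Fin N) ℂ)) hB
    (hermitian N) (Complex.I • 1) (fun Z => ?_) hN
  · filter_upwards [hdec] with V hV hVSU
    obtain ⟨p, hp, h, hh, hu, θ, hθ, hVeq⟩ := hV
    have hmem : (1 + h) * NormedSpace.exp (θ • (Complex.I • (1 : Matrix (Fin N) (Fin N) ℂ))) ∈
        Matrix.specialUnitaryGroup (Fin N) ℂ := by
      have h1 := mul_mem (star_mem_specialUnitaryGroup hp.1) (hVeq ▸ hVSU)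
      rwa [← mul_assoc, star_mul_self_of_mem hp.1, one_mul] at h1
    have h1 : V = p := hVeq.trans
      ((congrArg (p * ·) (eq_one_of_factor (NeZero.ne N) hh hu hθ hmem)).trans (mul_one p))
    rw [h1]
    exact hp.2.1
  · obtain ⟨A, hA, h, hh, θ, rfl⟩ := exists_su_add_hermitian Z
    obtain ⟨s, rfl⟩ := hts A (lieSpan_le_orbitSpan hS hM (hspan ▸ hA))
    exact ⟨s, h, hh, θ, rfl⟩

/-- For large `k` the root `exp(A/(k+1))` is close enough to `1` to lie in `M`, and `exp A` is a
power of it. -/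
lemma exp_mem_of_eventually_mem
    (h : ∀ᶠ V in 𝓝 (1 : Matrix (Fin N) (Fin N) ℂ),
      V ∈ Matrix.specialUnitaryGroup (Fin N) ℂ → V ∈ M)
    {A : Matrix (Fin N) (Fin N) ℂ} (hA : A ∈ su N) : NormedSpace.exp A ∈ M := by
  have hlim : Filter.Tendsto (fun k : ℕ => NormedSpace.exp (((k : ℝ) + 1)⁻¹ • A)) Filter.atTop
      (𝓝 1) := by
    have h1 : Filter.Tendsto (fun k : ℕ => ((k : ℝ) + 1)⁻¹ • A) Filter.atTop (𝓝 0) := by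
      have h2 : Filter.Tendsto (fun k : ℕ => ((k : ℝ) + 1)⁻¹) Filter.atTop (𝓝 0) := by
        simpa using tendsto_one_div_add_atTop_nhds_zero_nat (𝕜 := ℝ)
      simpa using h2.smul_const A
    have h3 : Filter.Tendsto (NormedSpace.exp : Matrix (Fin N) (Fin N) ℂ → _) (𝓝 0) (𝓝 1) := by
      have := (NormedSpace.exp_continuous (𝔸 := Matrix (Fin N) (Fin N) ℂ)).tendsto 0
      rwa [NormedSpace.exp_zero] at this
    exact h3.comp h1
  obtain ⟨k, hk⟩ := (hlim.eventually h).exists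
  have hmem := hk (exp_mem_specialUnitaryGroup ((su N).smul_mem _ hA))
  have hpow : NormedSpace.exp A = NormedSpace.exp (((k : ℝ) + 1)⁻¹ • A) ^ (k + 1) := by
    rw [← Matrix.exp_nsmul, ← Nat.cast_smul_eq_nsmul ℝ, smul_smul]
    push_cast
    rw [mul_inv_cancel₀ (by positivity), one_smul]
  rw [hpow]
  exact pow_mem hmem _

/-- A submonoid which contains the one-parameter groups of a set generating `𝔰𝔲(N)` contains
`SU(N)`. -/
theorem specialUnitaryGroup_le_of_lieSpan_eq {r : ℕ} {S : Set (Op r)} {M : Submonoid (Op r)}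
    (hspan : LieSubalgebra.lieSpan ℝ (Op r) S = su (r + 1))
    (hM : ∀ A ∈ S, ∀ s : ℝ, NormedSpace.exp (s • A) ∈ M) :
    Matrix.specialUnitaryGroup (Fin (r + 1)) ℂ ≤ M := by
  intro V hV
  have h := eventually_mem_of_lieSpan_eq hspan hM
  obtain ⟨A, hA, B, hB, rfl⟩ := exists_exp_mul_exp_eq hV
  exact mul_mem (exp_mem_of_eventually_mem h hA) (exp_mem_of_eventually_mem h hB)

end Orbit

/-! ### Steering by smooth controls -/

section Steering

variable {𝔸 : Type*} [NormedRing 𝔸] [NormedAlgebra ℝ 𝔸]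

/-- The smooth control `α`, which vanishes outside of `(0, 1)`, drives the solution `U` of
`U' = h(α) U` from `1` to `V`. -/
structure Steers (h : ℂ →ₗ[ℝ] 𝔸) (α : ℝ → ℂ) (U : ℝ → 𝔸) (V : 𝔸) : Prop where
  contDiff : ContDiff ℝ ∞ α
  control_of_nonpos : ∀ t ≤ 0, α t = 0
  control_of_one_le : ∀ t, 1 ≤ t → α t = 0
  of_nonpos : ∀ t ≤ 0, U t = 1
  of_one_le : ∀ t, 1 ≤ t → U t = V
  hasDerivAt : ∀ t, HasDerivAt U (h (α t) * U t) t

lemma Steers.refl (h : ℂ →ₗ[ℝ] 𝔸) : Steers h 0 1 1 where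
  contDiff := contDiff_const
  control_of_nonpos _ _ := rfl
  control_of_one_le _ _ := rfl
  of_nonpos _ _ := rfl
  of_one_le _ _ := rfl
  hasDerivAt t := by simpa using! hasDerivAt_const t (1 : 𝔸)

lemma hasDerivAt_comp_two_mul_sub {U : ℝ → 𝔸} {U' : 𝔸} {c t : ℝ}
    (hU : HasDerivAt U U' (2 * t - c)) :
    HasDerivAt (fun t => U (2 * t - c)) ((2 : ℝ) • U') t := by
  have h1 : HasDerivAt (fun t : ℝ => 2 * t - c) 2 t := by
    simpa using ((hasDerivAt_id t).const_mul 2).sub_const c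
  exact hU.scomp t h1

/-- Both motions are run at double speed, one after the other. Since controls vanish outside `(0,
1)`, concatenation is a sum and smoothness needs no gluing. The `- 0` gives both halves the form of
`hasDerivAt_comp_two_mul_sub`. -/
lemma Steers.trans {h : ℂ →ₗ[ℝ] 𝔸} {α β : ℝ → ℂ} {U W : ℝ → 𝔸} {V X : 𝔸}
    (hU : Steers h α U V) (hW : Steers h β W X) :
    Steers h (fun t => (2 : ℝ) • β (2 * t - 1) + (2 : ℝ) • α (2 * t - 0))
      (fun t => W (2 * t - 1) * U (2 * t - 0)) (X * V) where
  contDiff := by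
    have h1 := hU.contDiff
    have h2 := hW.contDiff
    fun_prop
  control_of_nonpos t ht := by
    rw [hW.control_of_nonpos _ (by linarith), hU.control_of_nonpos _ (by linarith)]
    simp
  control_of_one_le t ht := by
    rw [hW.control_of_one_le _ (by linarith), hU.control_of_one_le _ (by linarith)]
    simp
  of_nonpos t ht := by
    rw [hW.of_nonpos _ (by linarith), hU.of_nonpos _ (by linarith), one_mul]
  of_one_le t ht := by
    rw [hW.of_one_le _ (by linarith), hU.of_one_le _ (by linarith)]
  hasDerivAt t := by
    refine ((hasDerivAt_comp_two_mul_sub (hW.hasDerivAt _)).mul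
      (hasDerivAt_comp_two_mul_sub (hU.hasDerivAt _))).congr_deriv ?_
    rw [map_add, map_smul, map_smul, add_mul, smul_mul_assoc, smul_mul_assoc, smul_mul_assoc,
      mul_smul_comm, mul_assoc]
    congr 2
    -- The term `W h(α) U` must become `h(α) W U`: in the first half `W = 1`, in the second `α = 0`.
    rcases le_total (2 * t) 1 with ht | ht
    · rw [hW.of_nonpos (2 * t - 1) (by linarith)]
      simp
    · rw [hU.control_of_one_le (2 * t - 0) (by linarith)]
      simp

/-- The endpoints which smooth controls reach from `1`. -/
def reachable (h : ℂ →ₗ[ℝ] 𝔸) : Submonoid 𝔸 where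
  carrier := {V | ∃ α U, Steers h α U V}
  one_mem' := ⟨0, 1, Steers.refl h⟩
  mul_mem' := by
    rintro X V ⟨β, W, hW⟩ ⟨α, U, hU⟩
    exact ⟨_, _, hU.trans hW⟩

variable [CompleteSpace 𝔸]

/-- The one-parameter group is traversed with a smooth step `φ` as its clock, so the control is `φ'
v`. Outside `(0, 1)` the step is at an extremum, hence `φ' = 0` there, endpoints included. -/
lemma exp_mem_reachable (h : ℂ →ₗ[ℝ] 𝔸) (v : ℂ) : NormedSpace.exp (h v) ∈ reachable h := by
  have hφ : ContDiff ℝ ∞ Real.smoothTransition := Real.smoothTransition.contDiff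
  refine ⟨fun t => deriv Real.smoothTransition t • v,
    fun t => NormedSpace.exp (Real.smoothTransition t • h v), ?_, ?_, ?_, ?_, ?_, ?_⟩
  · exact (hφ.deriv' (n := ∞)).smul contDiff_const
  · intro t ht
    have : IsLocalMin Real.smoothTransition t := Filter.Eventually.of_forall fun s => by
      rw [Real.smoothTransition.zero_of_nonpos ht]
      exact Real.smoothTransition.nonneg s
    simp only [this.deriv_eq_zero, zero_smul]
  · intro t ht
    have : IsLocalMax Real.smoothTransition t := Filter.Eventually.of_forall fun s => by
      rw [Real.smoothTransition.one_of_one_le ht]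
      exact Real.smoothTransition.le_one s
    simp only [this.deriv_eq_zero, zero_smul]
  · intro t ht
    simp [Real.smoothTransition.zero_of_nonpos ht]
  · intro t ht
    simp [Real.smoothTransition.one_of_one_le ht]
  · intro t
    have h1 : HasDerivAt Real.smoothTransition (deriv Real.smoothTransition t) t :=
      (hφ.differentiable (by simp)).differentiableAt.hasDerivAt
    have h2 := (hasDerivAt_exp_smul_const' (𝕂 := ℝ) (h v) (Real.smoothTransition t)).scomp t h1
    refine h2.congr_deriv ?_
    rw [map_smul, smul_mul_assoc]

end Steering

/-! ### Linear differential equations -/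

section LinearODE

open Set

lemma hasDerivWithinAt_piecewise {E : Type*} [NormedAddCommGroup E] [NormedSpace ℝ E]
    {f g : ℝ → E} {v : ℝ → E → E} {a b c : ℝ} (hab : a ≤ b) (hbc : b ≤ c) (hfg : f b = g b)
    (hf : ∀ t ∈ Icc a b, HasDerivWithinAt f (v t (f t)) (Icc a b) t)
    (hg : ∀ t ∈ Icc b c, HasDerivWithinAt g (v t (g t)) (Icc b c) t) {t : ℝ}
    (ht : t ∈ Icc a c) :
    HasDerivWithinAt (fun t => if t ≤ b then f t else g t)
      (v t (if t ≤ b then f t else g t)) (Icc a c) t := by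
  have hF : EqOn (fun t => if t ≤ b then f t else g t) f (Icc a b) := fun s hs => if_pos hs.2
  have hG : EqOn (fun t => if t ≤ b then f t else g t) g (Icc b c) := fun s hs => by
    rcases hs.1.eq_or_lt with rfl | h
    · simp [hfg]
    · exact if_neg h.not_ge
  rcases lt_trichotomy t b with h | rfl | h
  · have htm : t ∈ Icc a b := ⟨ht.1, h.le⟩
    have h1 := (hf t htm).congr_of_mem hF htm
    rw [← hF htm] at h1
    refine h1.mono_of_mem_nhdsWithin ?_
    filter_upwards [self_mem_nhdsWithin, mem_nhdsWithin_of_mem_nhds (Iio_mem_nhds h)]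
      with s hs hs' using ⟨hs.1, le_of_lt hs'⟩
  · have hta : t ∈ Icc a t := ⟨hab, le_rfl⟩
    have htc : t ∈ Icc t c := ⟨le_rfl, hbc⟩
    have h1 := (hf t hta).congr_of_mem hF hta
    have h2 := (hg t htc).congr_of_mem hG htc
    rw [← hF hta] at h1
    rw [← hG htc] at h2
    rw [← Icc_union_Icc_eq_Icc hab hbc]
    exact h1.union h2
  · have htm : t ∈ Icc b c := ⟨h.le, ht.2⟩
    have h1 := (hg t htm).congr_of_mem hG htm
    rw [← hG htm] at h1
    refine h1.mono_of_mem_nhdsWithin ?_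
    filter_upwards [self_mem_nhdsWithin, mem_nhdsWithin_of_mem_nhds (Ioi_mem_nhds h)]
      with s hs hs' using ⟨le_of_lt hs', hs.2⟩

lemma lipschitzWith_mul_left {𝔸 : Type*} [NormedRing 𝔸] (a : 𝔸) {C : NNReal} (ha : ‖a‖ ≤ C) :
    LipschitzWith C fun x => a * x :=
  LipschitzWith.of_dist_le_mul fun x y => by
    rw [dist_eq_norm, dist_eq_norm, ← mul_sub]
    exact (norm_mul_le _ _).trans (by gcongr)

variable {𝔸 : Type*} [NormedRing 𝔸] [NormedAlgebra ℝ 𝔸]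

/-- Picard–Lindelöf on the unit ball about `1`. The admissible length `τ` does not depend on the
starting time, so the step can be iterated. -/
lemma exists_local_solution [CompleteSpace 𝔸] {A : ℝ → 𝔸} (hA : Continuous A) {C : NNReal}
    (hC : ∀ t, ‖A t‖ ≤ C) {τ : ℝ} (hτ : 0 ≤ τ) (hτC : (C * (‖(1 : 𝔸)‖ + 1)) * τ ≤ 1) (a : ℝ) :
    ∃ w : ℝ → 𝔸, w a = 1 ∧
      ∀ t ∈ Icc a (a + τ), HasDerivWithinAt w (A t * w t) (Icc a (a + τ)) t := by
  have hPL : IsPicardLindelof (fun t x => A t * x)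
      (⟨a, le_rfl, by linarith⟩ : Icc a (a + τ)) (1 : 𝔸) 1 0 (C * (‖(1 : 𝔸)‖₊ + 1)) C := by
    refine ⟨fun t _ => (lipschitzWith_mul_left _ (hC t)).lipschitzOnWith, fun x _ => ?_, ?_, ?_⟩
    · exact (hA.mul continuous_const).continuousOn
    · intro t _ x hx
      have hx1 : ‖x‖ ≤ ‖(1 : 𝔸)‖ + 1 := by
        have h1 : ‖x - 1‖ ≤ 1 := by simpa [dist_eq_norm] using hx
        have h2 := norm_add_le (1 : 𝔸) (x - 1)
        rw [add_sub_cancel] at h2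
        linarith
      refine (norm_mul_le _ _).trans ?_
      push_cast
      exact mul_le_mul (hC t) hx1 (norm_nonneg _) C.2
    · push_cast
      simpa [hτ] using hτC
  exact hPL.exists_eq_forall_mem_Icc_hasDerivWithinAt₀

/-- A linear equation with bounded continuous coefficients has solutions on all intervals. -/
lemma exists_solution [CompleteSpace 𝔸] {A : ℝ → 𝔸} (hA : Continuous A) {C : NNReal}
    (hC : ∀ t, ‖A t‖ ≤ C) (T : ℝ) :
    ∃ w : ℝ → 𝔸, w 0 = 1 ∧
      ∀ t ∈ Icc 0 T, HasDerivWithinAt w (A t * w t) (Icc 0 T) t := by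
  have hpos : 0 < C * (‖(1 : 𝔸)‖ + 1) + 1 := by positivity
  set τ : ℝ := (C * (‖(1 : 𝔸)‖ + 1) + 1)⁻¹ with hτdef
  have hτ : 0 < τ := inv_pos.2 hpos
  have hτC : (C * (‖(1 : 𝔸)‖ + 1)) * τ ≤ 1 := by
    rw [hτdef, ← div_eq_mul_inv, div_le_one hpos]
    linarith
  have key : ∀ n : ℕ, ∃ w : ℝ → 𝔸, w 0 = 1 ∧
      ∀ t ∈ Icc 0 (n * τ), HasDerivWithinAt w (A t * w t) (Icc 0 (n * τ)) t := by
    intro n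
    induction n with
    | zero =>
      simpa using exists_local_solution hA hC (τ := 0) le_rfl (by simp) 0
    | succ n ih =>
      obtain ⟨w, hw0, hw⟩ := ih
      obtain ⟨g, hg0, hg⟩ := exists_local_solution hA hC hτ.le hτC (n * τ)
      have hn : (0 : ℝ) ≤ n * τ := by positivity
      -- By linearity, a solution restarted from `1` is continued by right multiplication with the
      -- value reached so far.
      refine ⟨fun t => if t ≤ n * τ then w t else g t * w (n * τ), by simp [hn, hw0], ?_⟩
      rw [show ((n + 1 : ℕ) : ℝ) * τ = n * τ + τ by push_cast; ring]
      intro t ht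
      refine hasDerivWithinAt_piecewise (v := fun t x => A t * x) hn (by linarith)
        (by simp [hg0]) hw (fun s hs => ?_) ht
      rw [← mul_assoc]
      exact (hg s hs).mul_const _
  obtain ⟨n, hn⟩ := exists_nat_ge (T / τ)
  obtain ⟨w, hw0, hw⟩ := key n
  have hT : T ≤ n * τ := (div_le_iff₀ hτ).1 hn
  exact ⟨w, hw0, fun t ht => (hw t ⟨ht.1, ht.2.trans hT⟩).mono (Icc_subset_Icc_right hT)⟩

/-- The solutions of `w' = (T D + A) w` converge to that of `U' = A U` as `T → 0`. -/
lemma tendsto_solution_perturbation {A U : ℝ → 𝔸} {C : NNReal} (hC : ∀ t, ‖A t‖ ≤ C)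
    (hU0 : U 0 = 1) (hU : ∀ t, HasDerivAt U (A t * U t) t) (D : 𝔸) {w : ℝ → ℝ → 𝔸}
    (hw0 : ∀ T, w T 0 = 1)
    (hw : ∀ T, ∀ t ∈ Icc (0 : ℝ) 1,
      HasDerivWithinAt (w T) ((T • D + A t) * w T t) (Icc 0 1) t) :
    Filter.Tendsto (fun T => w T 1) (𝓝[>] 0) (𝓝 (U 1)) := by
  have hUc : Continuous U := continuous_iff_continuousAt.2 fun t => (hU t).continuousAt
  obtain ⟨R, hR⟩ := isCompact_Icc.exists_bound_of_continuousOn (s := Icc (0 : ℝ) 1)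
    hUc.continuousOn
  have hright : ∀ {f : ℝ → 𝔸} {f' : 𝔸} {t : ℝ}, t ∈ Ico (0 : ℝ) 1 →
      HasDerivWithinAt f f' (Icc 0 1) t → HasDerivWithinAt f f' (Ici t) t := by
    intro f f' t ht hf
    refine hf.mono_of_mem_nhdsWithin ?_
    filter_upwards [self_mem_nhdsWithin, mem_nhdsWithin_of_mem_nhds (Iio_mem_nhds ht.2)]
      with s hs hs' using ⟨ht.1.trans hs, le_of_lt hs'⟩
  have hbound : ∀ T ∈ Ioo (0 : ℝ) 1, dist (w T 1) (U 1) ≤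
      gronwallBound 0 (‖D‖₊ + C : NNReal) (0 + T * (‖D‖ * R)) (1 - 0) := by
    intro T hT
    -- `U` solves the perturbed equation up to an error `T ‖D‖ R`, and for `T < 1` the Lipschitz
    -- constant `‖D‖ + C` is independent of `T`.
    refine dist_le_of_approx_trajectories_ODE (v := fun t x => (T • D + A t) * x)
      (f' := fun t => (T • D + A t) * w T t) (g' := fun t => A t * U t)
      (a := 0) (b := 1) (fun t => lipschitzWith_mul_left _ ?_)
      (fun t ht => (hw T t ht).continuousWithinAt)
      (fun t ht => hright ht (hw T t (Ico_subset_Icc_self ht))) (fun t ht => ?_)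
      hUc.continuousOn (fun t _ => (hU t).hasDerivWithinAt) (fun t ht => ?_)
      (by rw [hw0, hU0, dist_self]) 1 ⟨zero_le_one, le_rfl⟩
    · refine (norm_add_le _ _).trans ?_
      push_cast
      refine add_le_add ?_ (hC _)
      rw [norm_smul, Real.norm_eq_abs, abs_of_pos hT.1]
      exact mul_le_of_le_one_left (norm_nonneg _) hT.2.le
    · rw [dist_self]
    · rw [add_mul, dist_eq_norm, sub_add_cancel_right,
        norm_neg, smul_mul_assoc, norm_smul, Real.norm_eq_abs, abs_of_pos hT.1]
      refine mul_le_mul_of_nonneg_left ((norm_mul_le _ _).trans ?_) hT.1.le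
      exact mul_le_mul_of_nonneg_left (hR t (Ico_subset_Icc_self ht)) (norm_nonneg _)
  rw [tendsto_iff_dist_tendsto_zero]
  have hlim : Filter.Tendsto (fun T : ℝ =>
      gronwallBound 0 (‖D‖₊ + C : NNReal) (0 + T * (‖D‖ * R)) (1 - 0)) (𝓝[>] 0) (𝓝 0) := by
    have hc : Continuous fun T : ℝ =>
        gronwallBound 0 (‖D‖₊ + C : NNReal) (0 + T * (‖D‖ * R)) (1 - 0) := by
      exact (gronwallBound_continuous_ε _ _ _).comp (by fun_prop)
    have := hc.tendsto 0
    simp only [zero_mul, add_zero, gronwallBound_ε0_δ0] at this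
    exact this.mono_left nhdsWithin_le_nhds
  refine squeeze_zero' (Filter.Eventually.of_forall fun _ => dist_nonneg) ?_ hlim
  filter_upwards [Ioo_mem_nhdsGT (zero_lt_one' ℝ)] with T hT using hbound T hT

lemma Steers.exists_bound {h : ℂ →ₗ[ℝ] 𝔸} {α : ℝ → ℂ} {U : ℝ → 𝔸} {V : 𝔸}
    (hs : Steers h α U V) : Continuous (fun t => h (α t)) ∧ ∃ C : NNReal, ∀ t, ‖h (α t)‖ ≤ C := by
  have hc : Continuous fun t => h (α t) :=
    h.continuous_of_finiteDimensional.comp hs.contDiff.continuous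
  obtain ⟨C, hC⟩ := isCompact_Icc.exists_bound_of_continuousOn (s := Icc (0 : ℝ) 1) hc.continuousOn
  refine ⟨hc, C.toNNReal, fun t => ?_⟩
  by_cases ht : t ∈ Icc (0 : ℝ) 1
  · exact (hC t ht).trans (Real.le_coe_toNNReal C)
  · have : α t = 0 := by
      rcases le_total t 0 with h0 | h0
      · exact hs.control_of_nonpos t h0
      · exact hs.control_of_one_le t (not_lt.1 fun h1 => ht ⟨h0, h1.le⟩)
    rw [this, map_zero, norm_zero]
    exact NNReal.coe_nonneg _

/-- This is the sped-up problem with drift `D`, written in the time `t/T` on `[0, 1]`: the control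
regains its original size and the drift becomes `T D`. -/
lemma Steers.exists_perturbation [CompleteSpace 𝔸] {h : ℂ →ₗ[ℝ] 𝔸} {α : ℝ → ℂ} {U : ℝ → 𝔸} {V : 𝔸}
    (hs : Steers h α U V) (D : 𝔸) :
    ∃ w : ℝ → ℝ → 𝔸, (∀ T, w T 0 = 1) ∧
      (∀ T, ∀ t ∈ Icc (0 : ℝ) 1,
        HasDerivWithinAt (w T) ((T • D + h (α t)) * w T t) (Icc 0 1) t) ∧
      Filter.Tendsto (fun T => w T 1) (𝓝[>] 0) (𝓝 V) := by
  obtain ⟨hc, C, hC⟩ := hs.exists_bound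
  have hex : ∀ T : ℝ, ∃ w : ℝ → 𝔸, w 0 = 1 ∧ ∀ t ∈ Icc (0 : ℝ) 1,
      HasDerivWithinAt w ((T • D + h (α t)) * w t) (Icc 0 1) t := fun T =>
    exists_solution (A := fun t => T • D + h (α t)) (C := ‖T • D‖₊ + C) (continuous_const.add hc)
      (fun t => (norm_add_le _ _).trans (by
        push_cast
        exact add_le_add le_rfl (hC t))) 1
  choose w hw0 hw using hex
  refine ⟨w, hw0, hw, ?_⟩
  rw [← hs.of_one_le 1 le_rfl]
  exact tendsto_solution_perturbation hC (hs.of_nonpos 0 le_rfl) hs.hasDerivAt D hw0 hw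

lemma div_mem_Icc {T t : ℝ} (hT : 0 < T) (ht : t ∈ Icc 0 T) : t / T ∈ Icc (0 : ℝ) 1 :=
  ⟨div_nonneg ht.1 hT.le, (div_le_one hT).2 ht.2⟩

lemma hasDerivWithinAt_comp_div {E : Type*} [NormedAddCommGroup E] [NormedSpace ℝ E]
    {w : ℝ → E} {w' : E} {T t : ℝ} (hT : 0 < T)
    (hw : HasDerivWithinAt w w' (Icc 0 1) (t / T)) :
    HasDerivWithinAt (fun t => w (t / T)) (T⁻¹ • w') (Icc 0 T) t := by
  have h1 : HasDerivWithinAt (fun t : ℝ => t / T) T⁻¹ (Icc 0 T) t := by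
    simpa using ((hasDerivAt_id t).div_const T).hasDerivWithinAt
  exact HasDerivWithinAt.scomp t hw h1 fun s hs => div_mem_Icc hT hs

lemma speedUp_eq_smul (α : ℝ → ℂ) (T t : ℝ) : speedUp α T t = T⁻¹ • α (t / T) :=
  (Complex.real_smul).symm

lemma hasDerivWithinAt_speedUp {h : ℂ →ₗ[ℝ] 𝔸} {α : ℝ → ℂ} {D : 𝔸} {w : ℝ → 𝔸} {T : ℝ}
    (hT : 0 < T) (hw : ∀ t ∈ Icc (0 : ℝ) 1,
      HasDerivWithinAt w ((T • D + h (α t)) * w t) (Icc 0 1) t) {t : ℝ} (ht : t ∈ Icc 0 T) :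
    HasDerivWithinAt (fun t => w (t / T)) ((D + h (speedUp α T t)) * w (t / T)) (Icc 0 T) t := by
  refine (hasDerivWithinAt_comp_div hT (hw _ (div_mem_Icc hT ht))).congr_deriv ?_
  rw [speedUp_eq_smul, map_smul, ← smul_mul_assoc, smul_add, smul_smul, inv_mul_cancel₀ hT.ne',
    one_smul]

end LinearODE

/-! ### Control of the blockade subspace -/

section Control

open scoped Matrix.Norms.Operator

/-- The generator `-i (χ Re α H_{c,R} + χ Im α H_{c,I})` of the driven evolution, as a real linear
function of the control. -/
noncomputable def generator (r : ℕ) (χ : ℝ) : ℂ →ₗ[ℝ] Op r where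
  toFun α := -Complex.I • control r χ α
  map_add' α β := by
    simp only [control, Complex.add_re, Complex.add_im]
    push_cast
    module
  map_smul' c α := by
    simp only [control, Complex.smul_re, Complex.smul_im, smul_eq_mul, RingHom.id_apply,
      ← Complex.coe_smul c (-Complex.I • _)]
    push_cast
    module

lemma generator_apply (r : ℕ) (χ : ℝ) (α : ℂ) :
    generator r χ α = -Complex.I • control r χ α := rfl

lemma specialUnitaryGroup_le_reachable {r : ℕ} (hr : 1 ≤ r) {χ : ℝ} (hχ : χ ≠ 0) :
    Matrix.specialUnitaryGroup (Fin (r + 1)) ℂ ≤ reachable (generator r χ) := by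
  refine specialUnitaryGroup_le_of_lieSpan_eq (lieSpan_controlR_controlI hr) ?_
  have hχ' : (χ : ℂ) ≠ 0 := by exact_mod_cast hχ
  rintro A (rfl | rfl) s
  -- The generator carries the factor `-iχ`, which fixes the constant control value `-s/χ`.
  · have : s • (Complex.I • controlR r) = generator r χ ((-s / χ : ℝ) : ℂ) := by
      rw [generator_apply, control, Complex.ofReal_re, Complex.ofReal_im, mul_zero,
        mul_div_cancel₀ _ hχ, ← Complex.coe_smul]
      push_cast
      module
    rw [this]
    exact exp_mem_reachable _ _
  · have : s • (Complex.I • controlI r) = generator r χ (((-s / χ : ℝ) : ℂ) * Complex.I) := by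
      rw [generator_apply, control, Complex.re_ofReal_mul, Complex.im_ofReal_mul, Complex.I_re,
        Complex.I_im, mul_zero, mul_zero, mul_one, mul_div_cancel₀ _ hχ, ← Complex.coe_smul]
      push_cast
      module
    rw [this]
    exact exp_mem_reachable _ _

lemma exists_isPropagator_speedUp {r : ℕ} (hr : 1 ≤ r) {χ : ℝ} (hχ : χ ≠ 0) (Δ₀ : ℝ) {V : Op r}
    (hV : V ∈ Matrix.specialUnitaryGroup (Fin (r + 1)) ℂ) :
    ∃ α : ℝ → ℂ, ContDiff ℝ ∞ α ∧
      (∀ T : ℝ, 0 < T → ∃ U : ℝ → Op r,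
        IsPropagator (fun t => control r χ (speedUp α T t)) T U ∧ U T = V) ∧
      ∃ W : ℝ → ℝ → Op r,
        (∀ T : ℝ, 0 < T → IsPropagator
          (fun t => drift r χ Δ₀ + control r χ (speedUp α T t)) T (W T)) ∧
        Filter.Tendsto (fun T => W T T) (𝓝[>] 0) (𝓝 V) := by
  obtain ⟨α, U, hs⟩ := specialUnitaryGroup_le_reachable hr hχ hV
  refine ⟨α, hs.contDiff, fun T hT => ⟨fun t => U (t / T), ⟨?_, fun t ht => ?_⟩, ?_⟩, ?_⟩
  · beta_reduce
    rw [zero_div]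
    exact hs.of_nonpos 0 le_rfl
  · have h := hasDerivWithinAt_speedUp (h := generator r χ) (α := α) (D := 0) (w := U) hT
      (fun t _ => by
        rw [smul_zero, zero_add]
        exact (hs.hasDerivAt t).hasDerivWithinAt) ht
    rw [zero_add, generator_apply, smul_mul_assoc] at h
    exact h
  · beta_reduce
    rw [div_self hT.ne']
    exact hs.of_one_le 1 le_rfl
  · obtain ⟨w, hw0, hw, hlim⟩ := hs.exists_perturbation (-Complex.I • drift r χ Δ₀)
    refine ⟨fun T t => w T (t / T), fun T hT => ⟨?_, fun t ht => ?_⟩, ?_⟩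
    · beta_reduce
      rw [zero_div]
      exact hw0 T
    · have h := hasDerivWithinAt_speedUp hT (hw T) ht
      rw [generator_apply, ← smul_add, smul_mul_assoc] at h
      exact h
    · refine hlim.congr' ?_
      filter_upwards [self_mem_nhdsWithin] with T hT
      rw [div_self (ne_of_gt hT)]

end Control

lemma contDiff_speedUp {α : ℝ → ℂ} (hα : ContDiff ℝ ∞ α) (T : ℝ) :
    ContDiff ℝ ∞ (speedUp α T) :=
  contDiff_const.mul (hα.comp (contDiff_id.div_const T))

end KerrBlockade

open KerrBlockade in
/-- Commutator of the two control terms, generation of `𝔰𝔲(r+1)`, and control in arbitrarily short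
time, in the `(r+1)`-dimensional blockade subspace of a Kerr oscillator. In the last part one
control shape `α`, sped up with growing amplitude, reaches `V` exactly in every time `T > 0` when
there is no drift, and in the limit `T → 0` when the drift is present. -/
theorem mainTheorem2 (r : ℕ) (hr : 1 ≤ r) :
    ⁅Complex.I • controlR r, Complex.I • controlI r⁆ =
        ∑ n : Fin (r + 1), ((level r n : ℂ) * Complex.I) • Matrix.single n n (1 : ℂ) ∧
      (⁅Complex.I • controlR r, Complex.I • controlI r⁆).trace = 0 ∧
      (⁅Complex.I • controlR r, Complex.I • controlI r⁆).IsDiag ∧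
      Anharmonic (level r) ∧
      LieSubalgebra.lieSpan ℝ (Op r)
        {⁅Complex.I • controlR r, Complex.I • controlI r⁆, Complex.I • controlR r} = su (r + 1) ∧
      LieSubalgebra.lieSpan ℝ (Op r)
        {Complex.I • controlR r, Complex.I • controlI r} = su (r + 1) ∧
      (∀ χ : ℝ, χ ≠ 0 → ∀ V ∈ Matrix.specialUnitaryGroup (Fin (r + 1)) ℂ, ∀ T : ℝ, 0 < T →
        ∃ α : ℝ → ℂ, ContDiff ℝ ∞ α ∧ ∃ U : ℝ → Op r,
          IsPropagator (fun t => control r χ (α t)) T U ∧ U T = V) ∧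
      (∀ χ Δ₀ : ℝ, χ ≠ 0 → ∀ V ∈ Matrix.specialUnitaryGroup (Fin (r + 1)) ℂ,
        ∃ α : ℝ → ℂ, ContDiff ℝ ∞ α ∧
          (∀ T : ℝ, 0 < T → ∃ U : ℝ → Op r,
            IsPropagator (fun t => control r χ (speedUp α T t)) T U ∧ U T = V) ∧
          ∃ W : ℝ → ℝ → Op r,
            (∀ T : ℝ, 0 < T → IsPropagator
              (fun t => drift r χ Δ₀ + control r χ (speedUp α T t)) T (W T)) ∧
            Filter.Tendsto (fun T => W T T) (𝓝[>] 0) (𝓝 V)) := by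
  have hdiag := lie_controlR_controlI r
  refine ⟨?_, ?_, ?_, anharmonic_level hr, lieSpan_lie_controlR hr, lieSpan_controlR_controlI hr,
    fun χ hχ V hV T hT => ?_, fun χ Δ₀ hχ V hV => exists_isPropagator_speedUp hr hχ Δ₀ hV⟩
  · rw [hdiag, ← Matrix.sum_single_eq_diagonal]
    refine Finset.sum_congr rfl fun n _ => ?_
    rw [Matrix.smul_single, smul_eq_mul, mul_one, mul_comm]
  · rw [Ring.lie_def, Matrix.trace_sub, Matrix.trace_mul_comm, sub_self]
  · rw [hdiag]
    exact Matrix.isDiag_diagonal _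
  -- The value `0` for `Δ₀` is arbitrary, as only the drift-free half is kept.
  · obtain ⟨α, hα, hU, -⟩ := exists_isPropagator_speedUp hr hχ 0 hV
    exact ⟨speedUp α T, contDiff_speedUp hα T, hU T hT⟩
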